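/- Let $G$ be a finite group and let $R$ be a $G$-Tambara functor such that the restriction $R(G/H)\to R(G/K)$ along every map $G/K\to G/H$ of transitive $G$-sets is injective. Let $G$ act on the commutative ring $R(G/e)$ by restriction along the right multiplications $G/e\to G/e$. For a commutative ring $S$ with $G$-action let $\mathrm{FP}(S)$ be the fixed-point $G$-Tambara functor, $\mathrm{FP}(S)(G/H)=S^H$ (more generally $\mathrm{FP}(S)(X)=\mathrm{Map}_G(X,S)$), with restrictions the inclusions and transfers and norms given by sums and products over cosets. Let $f\colon R\to \mathrm{FP}(R(G/e))$ be the unit of the adjunction between evaluation at $G/e$ and $\mathrm{FP}$; at level $G/H$ it is the restriction $R(G/H)\to R(G/e)^H$ along $G/e\to G/H$. A Tambara ideal $I$ of a $G$-Tambara functor $T$ is a family of ideals $I(G/H)\subseteq T(G/H)$, $H\le G$, closed under restrictions, transfers, norms and conjugations; the product $I\cdot J$ is the smallest Tambara ideal containing all $I(G/H)\cdot J(G/H)$. A Tambara ideal $\mathfrak p\neq T$ is prime if $I\cdot J\subseteq\mathfrak p$ implies $I\subseteq \mathfrak p$ or $J\subseteq\mathfrak p$. The Nakaoka spectrum $\mathrm{Spec}(T)$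 is the set of prime Tambara ideals, ordered by inclusion, with the topology generated by the closed sets $V(I)=\{\mathfrak p : I\subseteq\mathfrak p\}$, where $I$ runs through the Tambara ideals of $T$. Then contraction $\mathfrak q\mapsto f^{-1}(\mathfrak q)$ is a well-defined continuous bijection $$\mathrm{Spec}(\mathrm{FP}(R(G/e)))\longrightarrow \mathrm{Spec}(R).$$ Hence there is an isomorphism of posets $\mathrm{Spec}(R)\cong \mathrm{Spec}(R(G/e)^G)$, where the right-hand side is the set of prime ideals of the ring $R(G/e)^G$ ordered by inclusion; it is given by $\mathfrak p\mapsto \mathfrak p(G/e)\cap R(G/e)^G$. -/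

import Mathlib

universe u v w

noncomputable section

/-! ## Finite `G`-sets -/

/-- A finite `G`-set. -/
structure FinGSet (G : Type u) [Group G] where
  carrier : Type u
  [action : MulAction G carrier]
  [finite : Finite carrier]

namespace FinGSet

variable {G : Type u} [Group G]

instance : CoeSort (FinGSet G) (Type u) := ⟨FinGSet.carrier⟩

instance (X : FinGSet G) : MulAction G X := X.action

instance (X : FinGSet G) : Finite X := X.finite

/-- The transitive `G`-set `G/H`. -/
def orbit [Finite G] (H : Subgroup G) : FinGSet G where
  carrier := G ⧸ H

/-- A commutative square `f ∘ p = g ∘ q` of finite `G`-sets which is cartesian. -/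
structure IsPullback {W X Y Z : FinGSet G} (p : W →[G] X) (q : W →[G] Y)
    (f : X →[G] Z) (g : Y →[G] Z) : Prop where
  comm : ∀ w, f (p w) = g (q w)
  existsUnique : ∀ x y, f x = g y → ∃! w, p w = x ∧ q w = y

/-- An exponential diagram
`X ←f- A ←e- W -p→ P -q→ Y` over `g : X → Y`: the set `P` over `Y` is the dependent product
`Π_g A`, whose fibre over `y` consists of the sections `s : g⁻¹(y) → A` of `f`, the set `W` is
`X ×_Y Π_g A`, and `e` is the evaluation map `(x, s) ↦ s x`. -/
structure IsExponential {A X Y W P : FinGSet G} (f : A →[G] X) (g : X →[G] Y)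
    (e : W →[G] A) (p : W →[G] P) (q : P →[G] Y) : Prop where
  isPullback : IsPullback (f.comp e) p g q
  existsUnique : ∀ (y : Y) (s : {x : X // g x = y} → A), (∀ x, f (s x) = x.1) →
    ∃! z : P, q z = y ∧ ∀ (w : W) (x : {x : X // g x = y}), p w = z → f (e w) = x.1 → e w = s x

end FinGSet

open FinGSet

/-! ## Tambara functors -/

/-- A `G`-Tambara functor: commutative rings `R(X)` for all finite `G`-sets `X`, with restrictions,
transfers and norms along all maps of finite `G`-sets, which are functorial, send disjoint unions
to products, satisfy base change for all cartesian squares, and satisfy the distributive law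
for all exponential diagrams. (The empty set and disjoint unions `Z = X ⊔ Y` with inclusions
`i`, `j` are covered by `subsingleton_of_isEmpty` and `coprod_bijective`; together with the other
laws they force addition and multiplication to be transfer and norm along fold maps.) -/
structure TambaraFunctor (G : Type u) [Group G] where
  obj : FinGSet G → Type v
  [commRing : ∀ X, CommRing (obj X)]
  res : ∀ {X Y : FinGSet G}, (X →[G] Y) → (obj Y →+* obj X)
  tr : ∀ {X Y : FinGSet G}, (X →[G] Y) → (obj X →+ obj Y)
  nm : ∀ {X Y : FinGSet G}, (X →[G] Y) → (obj X →* obj Y)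
  res_id : ∀ {X : FinGSet G} (a : obj X), res (MulActionHom.id G) a = a
  tr_id : ∀ {X : FinGSet G} (a : obj X), tr (MulActionHom.id G) a = a
  nm_id : ∀ {X : FinGSet G} (a : obj X), nm (MulActionHom.id G) a = a
  res_comp : ∀ {X Y Z : FinGSet G} (g : Y →[G] Z) (f : X →[G] Y) (a : obj Z),
    res (g.comp f) a = res f (res g a)
  tr_comp : ∀ {X Y Z : FinGSet G} (g : Y →[G] Z) (f : X →[G] Y) (a : obj X),
    tr (g.comp f) a = tr g (tr f a)
  nm_comp : ∀ {X Y Z : FinGSet G} (g : Y →[G] Z) (f : X →[G] Y) (a : obj X),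
    nm (g.comp f) a = nm g (nm f a)
  subsingleton_of_isEmpty : ∀ X : FinGSet G, IsEmpty X → Subsingleton (obj X)
  coprod_bijective : ∀ {X Y Z : FinGSet G} (i : X →[G] Z) (j : Y →[G] Z),
    Function.Bijective (Sum.elim i j) →
      Function.Bijective (fun a : obj Z => (res i a, res j a))
  res_tr : ∀ {W X Y Z : FinGSet G} {p : W →[G] X} {q : W →[G] Y} {f : X →[G] Z} {g : Y →[G] Z},
    IsPullback p q f g → ∀ a : obj X, res g (tr f a) = tr q (res p a)
  res_nm : ∀ {W X Y Z : FinGSet G} {p : W →[G] X} {q : W →[G] Y} {f : X →[G] Z} {g : Y →[G] Z},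
    IsPullback p q f g → ∀ a : obj X, res g (nm f a) = nm q (res p a)
  nm_tr : ∀ {A X Y W P : FinGSet G} {f : A →[G] X} {g : X →[G] Y}
    {e : W →[G] A} {p : W →[G] P} {q : P →[G] Y},
    IsExponential f g e p q → ∀ a : obj A, nm g (tr f a) = tr q (nm p (res e a))

namespace TambaraFunctor

section Basic

variable {G : Type u} [Group G]

instance (R : TambaraFunctor.{u, v} G) (X : FinGSet G) : CommRing (R.obj X) := R.commRing X

/-- A morphism of `G`-Tambara functors. -/
structure Hom (R : TambaraFunctor.{u, v} G) (S : TambaraFunctor.{u, w} G) where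
  app : ∀ X : FinGSet G, R.obj X →+* S.obj X
  app_res : ∀ {X Y : FinGSet G} (f : X →[G] Y) (a : R.obj Y),
    app X (R.res f a) = S.res f (app Y a)
  app_tr : ∀ {X Y : FinGSet G} (f : X →[G] Y) (a : R.obj X),
    app Y (R.tr f a) = S.tr f (app X a)
  app_nm : ∀ {X Y : FinGSet G} (f : X →[G] Y) (a : R.obj X),
    app Y (R.nm f a) = S.nm f (app X a)

end Basic

/-! ### Tambara ideals and the Nakaoka spectrum -/

section Ideals

variable {G : Type u} [Group G] [Finite G]

/-- A Tambara ideal: ideals `I(G/H) ⊆ R(G/H)` closed under restrictions, transfers and norms along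
all maps between transitive `G`-sets `G/K → G/H`. (Each such map is the composite of a conjugation
isomorphism and a canonical projection, so this includes closure under conjugations.) -/
@[ext]
structure TambaraIdeal (R : TambaraFunctor.{u, v} G) where
  ideal : ∀ H : Subgroup G, Ideal (R.obj (orbit H))
  res_mem : ∀ {K H : Subgroup G} (f : orbit K →[G] orbit H) {a : R.obj (orbit H)},
    a ∈ ideal H → R.res f a ∈ ideal K
  tr_mem : ∀ {K H : Subgroup G} (f : orbit K →[G] orbit H) {a : R.obj (orbit K)},
    a ∈ ideal K → R.tr f a ∈ ideal H
  nm_mem : ∀ {K H : Subgroup G} (f : orbit K →[G] orbit H) {a : R.obj (orbit K)},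
    a ∈ ideal K → R.nm f a ∈ ideal H

namespace TambaraIdeal

variable {R : TambaraFunctor.{u, v} G}

/-- Tambara ideals are ordered by levelwise inclusion. -/
instance : PartialOrder (TambaraIdeal R) :=
  PartialOrder.lift TambaraIdeal.ideal fun _ _ h => TambaraIdeal.ext h

/-- The intersection of a family of Tambara ideals. -/
instance : InfSet (TambaraIdeal R) where
  sInf S :=
    { ideal := fun H => ⨅ I ∈ S, I.ideal H
      res_mem := fun f a ha => by
        simp only [Submodule.mem_iInf] at ha ⊢
        exact fun I hI => I.res_mem f (ha I hI)
      tr_mem := fun f a ha => by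
        simp only [Submodule.mem_iInf] at ha ⊢
        exact fun I hI => I.tr_mem f (ha I hI)
      nm_mem := fun f a ha => by
        simp only [Submodule.mem_iInf] at ha ⊢
        exact fun I hI => I.nm_mem f (ha I hI) }

/-- The product of two Tambara ideals: the smallest Tambara ideal which contains
`I(G/H) · J(G/H)` for all `H`. -/
instance : Mul (TambaraIdeal R) where
  mul I J := sInf {L | ∀ H, I.ideal H * J.ideal H ≤ L.ideal H}

/-- A Tambara ideal is proper if it is not all of `R`. -/
def IsProper (I : TambaraIdeal R) : Prop := ∃ H, I.ideal H ≠ ⊤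

/-- Prime Tambara ideals. -/
structure IsPrime (p : TambaraIdeal R) : Prop where
  isProper : p.IsProper
  le_or_le : ∀ I J : TambaraIdeal R, I * J ≤ p → I ≤ p ∨ J ≤ p

/-- The contraction of a Tambara ideal along a morphism. -/
def comap {S : TambaraFunctor.{u, w} G} (f : Hom R S) (I : TambaraIdeal S) : TambaraIdeal R where
  ideal H := (I.ideal H).comap (f.app (orbit H))
  res_mem g a ha := by
    rw [Ideal.mem_comap] at ha ⊢
    rw [f.app_res]
    exact I.res_mem g ha
  tr_mem g a ha := by
    rw [Ideal.mem_comap] at ha ⊢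
    rw [f.app_tr]
    exact I.tr_mem g ha
  nm_mem g a ha := by
    rw [Ideal.mem_comap] at ha ⊢
    rw [f.app_nm]
    exact I.nm_mem g ha

end TambaraIdeal

/-- The Nakaoka spectrum: the set of prime Tambara ideals (ordered by inclusion). -/
abbrev Spec (R : TambaraFunctor.{u, v} G) : Type (max u v) := {p : TambaraIdeal R // p.IsPrime}

/-- The topology on the Nakaoka spectrum, generated by the closed subsets
`V(I) = {p | I ⊆ p}`, where `I` runs through all Tambara ideals. -/
instance (R : TambaraFunctor.{u, v} G) : TopologicalSpace (Spec R) :=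
  TopologicalSpace.generateFrom {U | ∃ I : TambaraIdeal R, U = {p : Spec R | I ≤ p.1}ᶜ}

end Ideals

/-! ### The underlying `G`-ring -/

section Bottom

variable {G : Type u} [Group G] [Finite G]

/-- For `x ∈ X` the `G`-map `G/e → X`, `gH ↦ g x` (with `H = e`). For `X = G/e` and `x = g` it is
right multiplication by `g`. -/
def pointMap {X : FinGSet G} (x : X) : orbit (⊥ : Subgroup G) →[G] X where
  toFun := fun c : G ⧸ (⊥ : Subgroup G) => Quotient.liftOn' c (fun g => g • x) (by
    intro a b h
    rw [QuotientGroup.leftRel_apply, Subgroup.mem_bot, inv_mul_eq_one] at h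
    rw [h])
  map_smul' := by
    intro g c
    induction c using QuotientGroup.induction_on with
    | H a => exact mul_smul g a x

/-- The coset of `g` in `G/e`. -/
def elt (g : G) : orbit (⊥ : Subgroup G) := (QuotientGroup.mk g : G ⧸ (⊥ : Subgroup G))

theorem pointMap_elt {X : FinGSet G} (x : X) (g : G) : pointMap x (elt g) = g • x := rfl

theorem exists_elt (c : orbit (⊥ : Subgroup G)) : ∃ g, elt g = c :=
  QuotientGroup.mk_surjective (s := (⊥ : Subgroup G)) c

theorem smul_elt (g h : G) : g • elt h = elt (g * h) := rfl

theorem elt_injective {g h : G} (e : elt g = elt h) : g = h := by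
  have := (QuotientGroup.eq (s := (⊥ : Subgroup G))).1 e
  rwa [Subgroup.mem_bot, inv_mul_eq_one] at this

theorem comp_pointMap {X Y : FinGSet G} (f : X →[G] Y) (x : X) :
    f.comp (pointMap x) = pointMap (f x) := by
  ext c
  obtain ⟨g, rfl⟩ := exists_elt c
  exact map_smul f g x

theorem pointMap_one : pointMap (elt (1 : G)) = MulActionHom.id G := by
  ext c
  obtain ⟨g, rfl⟩ := exists_elt c
  rw [pointMap_elt, smul_elt, mul_one]
  rfl

/-- The commutative ring `R(G/e)`. -/
abbrev bottom (R : TambaraFunctor.{u, v} G) : Type v := R.obj (orbit (⊥ : Subgroup G))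

/-- The action of `G` on `R(G/e)`: the element `g` acts by restriction along right multiplication
by `g` on `G/e`. -/
instance (R : TambaraFunctor.{u, v} G) : MulSemiringAction G R.bottom where
  smul g a := R.res (pointMap (elt g)) a
  one_smul a := by
    change R.res (pointMap (elt (1 : G))) a = a
    rw [pointMap_one, R.res_id]
  mul_smul g h a := by
    change R.res (pointMap (elt (g * h))) a =
      R.res (pointMap (elt g)) (R.res (pointMap (elt h)) a)
    rw [← R.res_comp, comp_pointMap]
    rfl
  smul_zero g := map_zero _
  smul_add g := map_add _
  smul_one g := map_one _
  smul_mul g := map_mul _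

theorem smul_bottom (R : TambaraFunctor.{u, v} G) (g : G) (a : R.bottom) :
    g • a = R.res (pointMap (elt g)) a := rfl

end Bottom

/-! ### Fixed-point Tambara functors -/

section FixedPoints

/-- The product of the values of `a` over the fibre of `f` over `y`. -/
@[to_additive]
def fibreProd {X Y : Type u} {M : Type v} [CommMonoid M] (f : X → Y) (a : X → M) (y : Y) : M :=
  ∏ᶠ x : {x : X // f x = y}, a x.1

@[to_additive]
theorem fibreProd_eq {X Y : Type u} {M : Type v} [CommMonoid M] [Fintype X] [DecidableEq Y]
    (f : X → Y) (a : X → M) (y : Y) : fibreProd f a y = ∏ x with f x = y, a x := by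
  rw [fibreProd, finprod_eq_prod_of_fintype]
  exact (Finset.prod_subtype _ (by simp) a).symm

@[to_additive]
theorem fibreProd_id {X : Type u} {M : Type v} [CommMonoid M] (a : X → M) (y : X) :
    fibreProd (fun x => x) a y = a y := by
  rw [fibreProd, finprod_unique]
  rfl

@[to_additive]
theorem fibreProd_comp {X Y Z : Type u} [Finite X] [Finite Y] {M : Type v} [CommMonoid M]
    (g : Y → Z) (f : X → Y) (a : X → M) (z : Z) :
    fibreProd (fun x => g (f x)) a z = fibreProd g (fibreProd f a) z := by
  classical
  have := Fintype.ofFinite X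
  have := Fintype.ofFinite Y
  simp only [fibreProd_eq]
  rw [← Finset.prod_fiberwise_of_maps_to (t := Finset.univ.filter fun y => g y = z) (g := f)
    (by simp)]
  refine Finset.prod_congr rfl fun y hy => Finset.prod_congr ?_ fun _ _ => rfl
  ext x
  simp only [Finset.mem_filter, Finset.mem_univ, true_and] at hy ⊢
  exact ⟨fun h => h.2, fun h => ⟨h ▸ hy, h⟩⟩

@[to_additive]
theorem fibreProd_mul {X Y : Type u} [Finite X] {M : Type v} [CommMonoid M]
    (f : X → Y) (a b : X → M) (y : Y) :
    fibreProd f (fun x => a x * b x) y = fibreProd f a y * fibreProd f b y := by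
  classical
  have := Fintype.ofFinite X
  simp only [fibreProd_eq, Finset.prod_mul_distrib]

@[to_additive]
theorem fibreProd_cartesian {W X Y Z : Type u} {M : Type v} [CommMonoid M]
    {p : W → X} {q : W → Y} {f : X → Z} {g : Y → Z} (hc : ∀ w, f (p w) = g (q w))
    (h : ∀ x y, f x = g y → ∃! w, p w = x ∧ q w = y) (a : X → M) (y : Y) :
    fibreProd f a (g y) = fibreProd q (fun w => a (p w)) y := by
  symm
  refine finprod_eq_of_bijective
    (fun w : {w // q w = y} => (⟨p w.1, by rw [hc, w.2]⟩ : {x // f x = g y})) ⟨?_, ?_⟩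
    (fun _ => rfl)
  · rintro ⟨w, hw⟩ ⟨w', hw'⟩ e
    have e' : p w = p w' := congrArg Subtype.val e
    obtain ⟨_, _, hu⟩ := h (p w) y (by rw [hc, hw])
    exact Subtype.ext ((hu w ⟨rfl, hw⟩).trans (hu w' ⟨e'.symm, hw'⟩).symm)
  · rintro ⟨x, hx⟩
    obtain ⟨w, ⟨hp, hq⟩, -⟩ := h x y hx
    exact ⟨⟨w, hq⟩, Subtype.ext hp⟩

theorem smul_square {G : Type u} [Group G] {X Y : FinGSet G} (f : X →[G] Y) (g : G) (x : X)
    (y : Y) (h : f x = g • y) : ∃! w : X, g • w = x ∧ f w = y :=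
  ⟨g⁻¹ • x, ⟨smul_inv_smul g x, by rw [map_smul, h, inv_smul_smul]⟩, by
    rintro w ⟨rfl, -⟩
    exact (inv_smul_smul g w).symm⟩

theorem map_fibreProd {X Y : Type u} [Finite X] {M N : Type v} [CommMonoid M] [CommMonoid N]
    (f : X → Y) (a : X → M) (y : Y) (φ : M →* N) :
    φ (fibreProd f a y) = fibreProd f (fun x => φ (a x)) y := by
  classical
  have := Fintype.ofFinite X
  simp only [fibreProd_eq, map_prod]

theorem map_fibreSum {X Y : Type u} [Finite X] {M N : Type v} [AddCommMonoid M] [AddCommMonoid N]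
    (f : X → Y) (a : X → M) (y : Y) (φ : M →+ N) :
    φ (fibreSum f a y) = fibreSum f (fun x => φ (a x)) y := by
  classical
  have := Fintype.ofFinite X
  simp only [fibreSum_eq, map_sum]

theorem fibre_distrib {G : Type u} [Group G] {A X Y W P : FinGSet G} {M : Type v}
    [CommRing M] {f : A →[G] X} {g : X →[G] Y}
    {e : W →[G] A} {p : W →[G] P} {q : P →[G] Y} (h : IsExponential f g e p q)
    (a : A → M) (y : Y) :
    fibreProd g (fibreSum f a) y = fibreSum q (fibreProd p (fun w => a (e w))) y := by
  classical
  have := Fintype.ofFinite A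
  have := Fintype.ofFinite X
  have h1 : fibreProd g (fibreSum f a) y
      = ∑ s : (∀ x : {x : X // g x = y}, {b : A // f b = x.1}), ∏ x, a (s x).1 := by
    rw [fibreProd, finprod_eq_prod_of_fintype]
    simp only [fibreSum, finsum_eq_sum_of_fintype]
    exact Fintype.prod_sum _
  rw [h1, ← finsum_eq_sum_of_fintype]
  unfold fibreSum
  symm
  -- the element of `W` over `x` and `z`
  have hw : ∀ (z : {z : P // q z = y}) (x : {x : X // g x = y}),
      ∃! w : W, f (e w) = x.1 ∧ p w = z.1 := fun z x =>
    h.isPullback.existsUnique x.1 z.1 (by rw [x.2, z.2])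
  choose ω hω hωu using hw
  refine finsum_eq_of_bijective (fun z x => ⟨e (ω z x), (hω z x).1⟩) ⟨?_, ?_⟩ ?_
  · intro z z' hz
    obtain ⟨_, _, hu⟩ := h.existsUnique y (fun x => e (ω z x)) (fun x => (hω z x).1)
    have hz' : ∀ x, e (ω z x) = e (ω z' x) := fun x => congrArg Subtype.val (congrFun hz x)
    refine Subtype.ext ((hu z.1 ⟨z.2, ?_⟩).trans (hu z'.1 ⟨z'.2, ?_⟩).symm)
    · intro w x hpw hfw
      rw [hωu z x w ⟨hfw, hpw⟩]
    · intro w x hpw hfw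
      rw [hωu z' x w ⟨hfw, hpw⟩, hz' x]
  · intro s
    obtain ⟨z, ⟨hz, hs⟩, -⟩ := h.existsUnique y (fun x => (s x).1) (fun x => (s x).2)
    refine ⟨⟨z, hz⟩, funext fun x => Subtype.ext ?_⟩
    exact hs _ x (hω ⟨z, hz⟩ x).2 (hω ⟨z, hz⟩ x).1
  · intro z
    rw [← finprod_eq_prod_of_fintype]
    symm
    refine finprod_eq_of_bijective (fun x => ⟨ω z x, (hω z x).2⟩) ⟨?_, ?_⟩ (fun _ => rfl)
    · intro x x' hx
      refine Subtype.ext ?_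
      rw [← (hω z x).1, ← (hω z x').1]
      exact congrArg (fun w => f (e w)) (congrArg Subtype.val hx)
    · rintro ⟨w, hw⟩
      have hg : g (f (e w)) = y := by
        have := h.isPullback.comm w
        change g (f (e w)) = q (p w) at this
        rw [this, hw, z.2]
      exact ⟨⟨f (e w), hg⟩, Subtype.ext (hωu z ⟨f (e w), hg⟩ w ⟨rfl, hw⟩).symm⟩

variable {G : Type u} [Group G] (S : Type v) [CommRing S] [MulSemiringAction G S]

/-- The ring of `G`-equivariant functions `X → S`, with pointwise operations. For `X = G/H` it is
isomorphic to `S^H` by evaluation at the coset of the identity. -/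
def equivariantFunctions (X : FinGSet G) : Subring (X → S) where
  carrier := {a | ∀ (g : G) (x : X), a (g • x) = g • a x}
  mul_mem' ha hb g x := by simp only [Pi.mul_apply, smul_mul', ha g x, hb g x]
  one_mem' g x := (smul_one g).symm
  add_mem' ha hb g x := by simp only [Pi.add_apply, smul_add, ha g x, hb g x]
  zero_mem' g x := (smul_zero g).symm
  neg_mem' ha g x := by simp only [Pi.neg_apply, smul_neg, ha g x]

variable (G) in
/-- The fixed-point `G`-Tambara functor `FP(S)` of a `G`-ring `S`, with `FP(S)(X)` the ring of
`G`-maps `X → S`; restriction is precomposition, and transfers and norms are given by sums and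
products over the fibres. On transitive `G`-sets this is `FP(S)(G/H) = S^H`, restrictions are the
inclusions, and transfers and norms are the sums and products over cosets. -/
def fixedPoint : TambaraFunctor.{u, max u v} G where
  obj X := equivariantFunctions S X
  res f :=
    { toFun := fun a => ⟨fun x => a.1 (f x), fun g x => by
        change a.1 (f (g • x)) = g • a.1 (f x)
        rw [map_smul, a.2 g (f x)]⟩
      map_one' := rfl
      map_mul' := fun _ _ => rfl
      map_zero' := rfl
      map_add' := fun _ _ => rfl }
  tr f :=
    { toFun := fun a => ⟨fibreSum f a.1, fun g y => by
        rw [fibreSum_cartesian (p := fun x => g • x) (q := f) (g := fun y => g • y)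
          (fun x => map_smul f g x) (smul_square f g), show (fun x => a.1 (g • x)) = fun x => g • a.1 x from funext (a.2 g)]
        exact (map_fibreSum f a.1 y (MulSemiringAction.toRingHom G S g : S →+ S)).symm⟩
      map_zero' := by
        refine Subtype.ext (funext fun y => ?_)
        exact finsum_zero
      map_add' := fun a b => Subtype.ext (funext fun y => fibreSum_add f a.1 b.1 y) }
  nm f :=
    { toFun := fun a => ⟨fibreProd f a.1, fun g y => by
        rw [fibreProd_cartesian (p := fun x => g • x) (q := f) (g := fun y => g • y)
          (fun x => map_smul f g x) (smul_square f g), show (fun x => a.1 (g • x)) = fun x => g • a.1 x from funext (a.2 g)]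
        exact (map_fibreProd f a.1 y (MulSemiringAction.toRingHom G S g : S →* S)).symm⟩
      map_one' := by
        refine Subtype.ext (funext fun y => ?_)
        exact finprod_one
      map_mul' := fun a b => Subtype.ext (funext fun y => fibreProd_mul f a.1 b.1 y) }
  res_id _ := rfl
  tr_id a := Subtype.ext (funext fun y => fibreSum_id a.1 y)
  nm_id a := Subtype.ext (funext fun y => fibreProd_id a.1 y)
  res_comp _ _ _ := rfl
  tr_comp g f a := Subtype.ext (funext fun y => fibreSum_comp g f a.1 y)
  nm_comp g f a := Subtype.ext (funext fun y => fibreProd_comp g f a.1 y)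
  subsingleton_of_isEmpty X hX := ⟨fun a b => Subtype.ext (funext fun x => hX.elim x)⟩
  coprod_bijective {X Y Z} i j hij := by
    constructor
    · intro a b hab
      refine Subtype.ext (funext fun z => ?_)
      obtain ⟨x | y, rfl⟩ := hij.2 z
      · exact congrFun (congrArg (fun c => c.1.1) hab) x
      · exact congrFun (congrArg (fun c => c.2.1) hab) y
    · rintro ⟨a, b⟩
      let φ := Equiv.ofBijective _ hij
      have hl : ∀ x, φ.symm (i x) = Sum.inl x := fun x => φ.symm_apply_apply (Sum.inl x)
      have hr : ∀ x, φ.symm (j x) = Sum.inr x := fun x => φ.symm_apply_apply (Sum.inr x)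
      refine ⟨⟨fun z => Sum.elim a.1 b.1 (φ.symm z), fun g z => ?_⟩, ?_⟩
      · obtain ⟨x | y, rfl⟩ := hij.2 z
        · change Sum.elim a.1 b.1 (φ.symm (g • i x)) = g • Sum.elim a.1 b.1 (φ.symm (i x))
          rw [← map_smul, hl, hl]
          exact a.2 g x
        · change Sum.elim a.1 b.1 (φ.symm (g • j y)) = g • Sum.elim a.1 b.1 (φ.symm (j y))
          rw [← map_smul, hr, hr]
          exact b.2 g y
      · refine Prod.ext (Subtype.ext (funext fun x => ?_)) (Subtype.ext (funext fun x => ?_))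
        · change Sum.elim a.1 b.1 (φ.symm (i x)) = a.1 x
          rw [hl]
          rfl
        · change Sum.elim a.1 b.1 (φ.symm (j x)) = b.1 x
          rw [hr]
          rfl
  res_tr h a := Subtype.ext (funext fun y => fibreSum_cartesian h.comm h.existsUnique a.1 y)
  res_nm h a := Subtype.ext (funext fun y => fibreProd_cartesian h.comm h.existsUnique a.1 y)
  nm_tr h a := Subtype.ext (funext fun y => fibre_distrib h a.1 y)

end FixedPoints

/-! ### The adjunction unit `R → FP(R(G/e))` -/

section Unit

variable {G : Type u} [Group G]

/-- The empty `G`-set. -/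
def emptyGSet : FinGSet G where
  carrier := PEmpty
  action := { smul := fun _ x => x, one_smul := fun _ => rfl, mul_smul := fun _ _ _ => rfl }

/-- The product of a finite `G`-set with a finite set with trivial action. -/
def copies (I : Type u) [Finite I] (Z : FinGSet G) : FinGSet G where
  carrier := I × Z
  action :=
    { smul := fun g x => (x.1, g • x.2)
      one_smul := fun x => Prod.ext rfl (one_smul G x.2)
      mul_smul := fun g h x => Prod.ext rfl (mul_smul g h x.2) }

/-- The inclusion of a copy. -/
def copyIncl {I : Type u} [Finite I] {Z : FinGSet G} (i : I) : Z →[G] copies I Z where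
  toFun z := (i, z)
  map_smul' _ _ := rfl

/-- The fold map. -/
def copyFold {I : Type u} [Finite I] {Z : FinGSet G} : copies I Z →[G] Z where
  toFun z := z.2
  map_smul' _ _ := rfl

theorem res_jointly_injective (R : TambaraFunctor.{u, v} G) (I : Type u) [Finite I] :
    ∀ (Z W : FinGSet G) (ι : I → (Z →[G] W)),
      Function.Bijective (fun x : I × Z => ι x.1 x.2) →
      ∀ b b' : R.obj W, (∀ i, R.res (ι i) b = R.res (ι i) b') → b = b' := by
  refine Finite.induction_empty_option (P := fun I => ∀ (Z W : FinGSet G) (ι : I → (Z →[G] W)),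
      Function.Bijective (fun x : I × Z => ι x.1 x.2) →
      ∀ b b' : R.obj W, (∀ i, R.res (ι i) b = R.res (ι i) b') → b = b') ?_ ?_ ?_ I
  · intro I J e ih Z W ι hι b b' h
    refine ih Z W (fun i => ι (e i)) ?_ b b' fun i => h (e i)
    exact hι.comp (e.prodCongr (Equiv.refl _)).bijective
  · intro Z W ι hι b b' _
    have := R.subsingleton_of_isEmpty W ⟨fun w => by
      obtain ⟨x, -⟩ := hι.2 w
      exact x.1.elim⟩
    exact Subsingleton.elim _ _
  · intro I hI ih Z W ι hι b b' h
    have : Finite I := inferInstance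
    let j : copies I Z →[G] W :=
      { toFun := fun x => ι (some x.1) x.2
        map_smul' := fun g x => map_smul (ι (some x.1)) g x.2 }
    have hj : Function.Bijective (Sum.elim (ι none) j) := by
      constructor
      · rintro (z | ⟨i, z⟩) (z' | ⟨i', z'⟩) hz
        · have := @hι.1 (none, z) (none, z') hz
          simp_all
        · have := @hι.1 (none, z) (some i', z') hz
          simp at this
        · have := @hι.1 (some i, z) (none, z') hz
          simp at this
        · have := @hι.1 (some i, z) (some i', z') hz
          simp_all
      · intro w
        obtain ⟨⟨_ | i, z⟩, rfl⟩ := hι.2 w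
        · exact ⟨Sum.inl z, rfl⟩
        · exact ⟨Sum.inr (i, z), rfl⟩
    refine (R.coprod_bijective (ι none) j hj).1 (Prod.ext (h none) ?_)
    refine ih Z (copies I Z) copyIncl Function.bijective_id _ _ fun i => ?_
    rw [← R.res_comp, ← R.res_comp]
    exact h (some i)

theorem isPullback_copy {I : Type u} [Finite I] {Z : FinGSet G} (i : I) :
    IsPullback (MulActionHom.id G) (MulActionHom.id G)
      (copyIncl (Z := Z) i) (copyIncl (Z := Z) i) where
  comm _ := rfl
  existsUnique x _ h := ⟨x, ⟨rfl, congrArg Prod.snd h⟩, fun _ h => h.1⟩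

theorem isPullback_copy_ne {I : Type u} [Finite I] {Z : FinGSet G} {i j : I} (hij : i ≠ j) :
    IsPullback (W := emptyGSet) ⟨fun x => x.elim, fun _ x => x.elim⟩
      ⟨fun x => x.elim, fun _ x => x.elim⟩
      (copyIncl (Z := Z) i) (copyIncl (Z := Z) j) where
  comm x := PEmpty.elim x
  existsUnique _ _ h := absurd (congrArg Prod.fst h) hij

theorem tr_copyFold (R : TambaraFunctor.{u, v} G) (I : Type u) [Fintype I] (Z : FinGSet G)
    (b : R.obj (copies I Z)) :
    R.tr copyFold b = ∑ i, R.res (copyIncl i) b := by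
  classical
  have hb : b = ∑ i, R.tr (copyIncl i) (R.res (copyIncl i) b) := by
    refine res_jointly_injective R I Z (copies I Z) copyIncl Function.bijective_id _ _ fun j => ?_
    rw [map_sum, Finset.sum_eq_single j]
    · rw [R.res_tr (isPullback_copy j), R.tr_id, R.res_id]
    · intro i _ hij
      rw [R.res_tr (isPullback_copy_ne hij)]
      have := R.subsingleton_of_isEmpty emptyGSet ⟨fun x => PEmpty.elim x⟩
      rw [Subsingleton.elim (R.res _ _) 0, map_zero]
    · simp
  conv_lhs => rw [hb]
  rw [map_sum]
  refine Finset.sum_congr rfl fun i _ => ?_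
  rw [← R.tr_comp]
  exact R.tr_id _

theorem nm_copyFold (R : TambaraFunctor.{u, v} G) (I : Type u) [Fintype I] (Z : FinGSet G)
    (b : R.obj (copies I Z)) :
    R.nm copyFold b = ∏ i, R.res (copyIncl i) b := by
  classical
  have hb : b = ∏ i, R.nm (copyIncl i) (R.res (copyIncl i) b) := by
    refine res_jointly_injective R I Z (copies I Z) copyIncl Function.bijective_id _ _ fun j => ?_
    rw [map_prod, Finset.prod_eq_single j]
    · rw [R.res_nm (isPullback_copy j), R.nm_id, R.res_id]
    · intro i _ hij
      rw [R.res_nm (isPullback_copy_ne hij)]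
      have := R.subsingleton_of_isEmpty emptyGSet ⟨fun x => PEmpty.elim x⟩
      rw [Subsingleton.elim (R.res _ _) 1, map_one]
    · simp
  conv_lhs => rw [hb]
  rw [map_prod]
  refine Finset.prod_congr rfl fun i _ => ?_
  rw [← R.nm_comp]
  exact R.nm_id _

variable [Finite G]

/-- The map from copies of `G/e`, indexed by a fibre of `f`, to the source of `f`. -/
def fibreCover {X Y : FinGSet G} (f : X →[G] Y) (y : Y) :
    copies {x : X // f x = y} (orbit (⊥ : Subgroup G)) →[G] X where
  toFun c := pointMap c.1.1 c.2
  map_smul' g c := map_smul (pointMap c.1.1) g c.2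

theorem isPullback_fibreCover {X Y : FinGSet G} (f : X →[G] Y) (y : Y) :
    IsPullback (fibreCover f y) copyFold f (pointMap y) where
  comm := by
    rintro ⟨⟨x, rfl⟩, c⟩
    exact DFunLike.congr_fun (comp_pointMap f x) c
  existsUnique x c h := by
    obtain ⟨g, rfl⟩ := exists_elt c
    rw [pointMap_elt] at h
    refine ⟨(⟨g⁻¹ • x, by rw [map_smul, h, inv_smul_smul]⟩, elt g), ⟨?_, rfl⟩, ?_⟩
    · exact smul_inv_smul g x
    · rintro ⟨⟨x', hx'⟩, c'⟩ ⟨h1, h2⟩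
      have h2' : c' = elt g := h2
      subst h2'
      have h1' : g • x' = x := h1
      subst h1'
      exact Prod.ext (Subtype.ext (inv_smul_smul g x').symm) rfl

/-- The unit `R → FP(R(G/e))` of the adjunction between evaluation at `G/e` (from `G`-Tambara
functors to `G`-rings) and the fixed-point functor `FP`. It sends `a ∈ R(X)` to the `G`-map
`X → R(G/e)` with value at `x` the restriction of `a` along `G/e → X`, `g ↦ g x`. Under
`FP(R(G/e))(G/H) = R(G/e)^H` it is the restriction along `G/e → G/H`; at `G/e` it is the
identity. -/
def unit (R : TambaraFunctor.{u, v} G) : Hom R (fixedPoint G R.bottom) where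
  app X :=
    { toFun := fun a => ⟨fun x => R.res (pointMap x) a, fun g x => by
        rw [smul_bottom, ← R.res_comp, comp_pointMap]
        rfl⟩
      map_one' := Subtype.ext (funext fun x => map_one _)
      map_mul' := fun a b => Subtype.ext (funext fun x => map_mul _ a b)
      map_zero' := Subtype.ext (funext fun x => map_zero _)
      map_add' := fun a b => Subtype.ext (funext fun x => map_add _ a b) }
  app_res f a := Subtype.ext (funext fun x => by
    change R.res (pointMap x) (R.res f a) = R.res (pointMap (f x)) a
    rw [← R.res_comp, comp_pointMap])
  app_tr {X Y} f a := Subtype.ext (funext fun y => by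
    change R.res (pointMap y) (R.tr f a) = fibreSum f (fun x => R.res (pointMap x) a) y
    have := Fintype.ofFinite {x : X // f x = y}
    rw [R.res_tr (isPullback_fibreCover f y), tr_copyFold, fibreSum, finsum_eq_sum_of_fintype]
    refine Finset.sum_congr rfl fun x _ => ?_
    rw [← R.res_comp]
    rfl)
  app_nm {X Y} f a := Subtype.ext (funext fun y => by
    change R.res (pointMap y) (R.nm f a) = fibreProd f (fun x => R.res (pointMap x) a) y
    have := Fintype.ofFinite {x : X // f x = y}
    rw [R.res_nm (isPullback_fibreCover f y), nm_copyFold, fibreProd, finprod_eq_prod_of_fintype]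
    refine Finset.prod_congr rfl fun x _ => ?_
    rw [← R.res_comp]
    rfl)

end Unit

end TambaraFunctor

end

/-!
The point is that prime Tambara ideals `p` are levelwise radical when `nm f (res f a)` is the power
of `a` with exponent the cardinality of the fibres of `f`, for all maps `f` between transitive
`G`-sets. This identity holds in fixed-point functors, hence in every Tambara functor with injective
restrictions, as such a functor embeds into a fixed-point functor.

For `a ∈ R(G/H)` let `I m` be the Tambara ideal generated by the norms of restrictions of `a` along
diagrams `X ← Y → G/H` such that all fibres of `Y → X` have at least `m` points. Then `a ∈ I 1` and
`I m * I k ≤ I (m + k)`, so that `a ∈ p` as soon as `I m ≤ p` for some `m`. If `a ^ n ∈ p` then, by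
the pigeonhole principle, each fibre of `Y → X` with at least `n * |G/H|` points contains `n` points
with the same image in `G/H`; factoring the norm through `X × G/H` exhibits a factor `a ^ n`, and so
`I (n * |G/H|) ≤ p`.

Applied to maps `G/e → G/H`, radicality shows that `p` is determined by `p(G/e)`. By the theory of
finite groups acting on rings, the radical `G`-stable ideal `p(G/e)` is determined by its
invariants, and the prime Tambara ideals are those induced from the prime ideals of `R(G/e)`. Since
contraction of induced ideals is contraction of ideals at the level `G/e`, it is bijective on
spectra as soon as the morphism is bijective at that level.
-/

noncomputable section

open FinGSet

namespace FinGSet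

section Constructions

variable {G : Type u} [Group G]

/-- The finite `G`-set carried by an invariant subset of a `G`-set. -/
abbrev ofSubMulAction {X : Type u} [MulAction G X] [Finite X] (s : SubMulAction G X) :
    FinGSet G where
  carrier := s

/-- The product of two finite `G`-sets, with the diagonal action. -/
abbrev prod (X Y : FinGSet G) : FinGSet G where
  carrier := X × Y

/-- The disjoint union of two finite `G`-sets. -/
abbrev coprod (X Y : FinGSet G) : FinGSet G where
  carrier := X ⊕ Y

/-- The inclusion of the first summand of a disjoint union. -/
def inl (X Y : FinGSet G) : X →[G] coprod X Y where
  toFun := Sum.inl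
  map_smul' _ _ := rfl

/-- The inclusion of the second summand of a disjoint union. -/
def inr (X Y : FinGSet G) : Y →[G] coprod X Y where
  toFun := Sum.inr
  map_smul' _ _ := rfl

/-- The map out of a disjoint union with given restrictions to the summands. -/
def copair {X Y Z : FinGSet G} (f : X →[G] Z) (g : Y →[G] Z) : coprod X Y →[G] Z where
  toFun := Sum.elim f g
  map_smul' a z := z.rec (map_smul f a) (map_smul g a)

/-- The disjoint union of two maps. -/
def sumMap {X X' Y Y' : FinGSet G} (f : X →[G] Y) (f' : X' →[G] Y') :
    coprod X X' →[G] coprod Y Y' :=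
  copair ((inl Y Y').comp f) ((inr Y Y').comp f')

/-- The fold map `X ⊔ X → X`. -/
def fold (X : FinGSet G) : coprod X X →[G] X :=
  copair (MulActionHom.id G) (MulActionHom.id G)

/-- The map from the empty `G`-set. -/
def ofEmpty (X : FinGSet G) : (TambaraFunctor.emptyGSet : FinGSet G) →[G] X where
  toFun := PEmpty.elim
  map_smul' _ x := x.elim

theorem bijective_inl_inr (X Y : FinGSet G) :
    Function.Bijective (Sum.elim (inl X Y) (inr X Y)) := by
  have h : Sum.elim (inl X Y) (inr X Y) = id := Sum.elim_inl_inr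
  exact h ▸ Function.bijective_id

end Constructions

section Pullbacks

variable {G : Type u} [Group G] {W X X' Y Y' Z : FinGSet G}

theorem exists_isPullback (f : X →[G] Z) (g : Y →[G] Z) :
    ∃ (W : FinGSet G) (p : W →[G] X) (q : W →[G] Y), IsPullback p q f g := by
  let s : SubMulAction G (X × Y) :=
    { carrier := {z | f z.1 = g z.2}
      smul_mem' := fun c z (hz : f z.1 = g z.2) => by
        change f (c • z.1) = g (c • z.2)
        rw [map_smul, map_smul, hz] }
  refine ⟨ofSubMulAction s, (MulActionHom.fst G X Y).comp s.subtype,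
    (MulActionHom.snd G X Y).comp s.subtype, fun w => w.2, fun x y h => ?_⟩
  exact ⟨⟨(x, y), h⟩, ⟨rfl, rfl⟩, fun w hw => Subtype.ext (Prod.ext hw.1 hw.2)⟩

theorem IsPullback.symm {p : W →[G] X} {q : W →[G] Y} {f : X →[G] Z} {g : Y →[G] Z}
    (h : IsPullback p q f g) : IsPullback q p g f where
  comm w := (h.comm w).symm
  existsUnique y x e := by simpa only [and_comm] using h.existsUnique x y e.symm

theorem IsPullback.surjective {p : W →[G] X} {q : W →[G] Y} {f : X →[G] Z} {g : Y →[G] Z}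
    (h : IsPullback p q f g) (hf : Function.Surjective f) : Function.Surjective q := by
  intro y
  obtain ⟨x, hx⟩ := hf (g y)
  obtain ⟨w, ⟨-, hw⟩, -⟩ := h.existsUnique x y hx
  exact ⟨w, hw⟩

theorem IsPullback.card_fibre {p : W →[G] X} {q : W →[G] Y} {f : X →[G] Z} {g : Y →[G] Z}
    (h : IsPullback p q f g) (y : Y) :
    Nat.card {w // q w = y} = Nat.card {x // f x = g y} := by
  refine Nat.card_congr (Equiv.ofBijective (fun w => ⟨p w.1, by rw [h.comm, w.2]⟩) ⟨?_, ?_⟩)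
  · rintro ⟨w, hw⟩ ⟨w', hw'⟩ e
    exact Subtype.ext ((h.existsUnique (p w) y (by rw [h.comm, hw])).unique
      ⟨rfl, hw⟩ ⟨(congrArg Subtype.val e).symm, hw'⟩)
  · rintro ⟨x, hx⟩
    obtain ⟨w, ⟨hp, hq⟩, -⟩ := h.existsUnique x y hx
    exact ⟨⟨w, hq⟩, Subtype.ext hp⟩

theorem card_fibre_eq_add {X X' Z Y : Type u} [Finite X] [Finite X'] {i : X → Z} {j : X' → Z}
    (h : Function.Bijective (Sum.elim i j)) (f : Z → Y) (y : Y) :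
    Nat.card {z // f z = y} = Nat.card {x // f (i x) = y} + Nat.card {x // f (j x) = y} := by
  rw [← Nat.card_sum]
  exact (Nat.card_congr ((Equiv.subtypeSum (p := fun s => f (Sum.elim i j s) = y)).symm.trans
    ((Equiv.ofBijective _ h).subtypeEquiv fun _ => Iff.rfl))).symm

theorem card_fibre_smul (f : X →[G] Y) (g : G) (y : Y) :
    Nat.card {x // f x = g • y} = Nat.card {x // f x = y} :=
  Nat.card_congr ((MulAction.toPerm g).subtypeEquiv fun x => by
    rw [MulAction.toPerm_apply, map_smul, smul_left_cancel_iff]).symm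

theorem isPullback_inl (f : X →[G] Y) (f' : X' →[G] Y') :
    IsPullback (inl X X') f (sumMap f f') (inl Y Y') where
  comm _ := rfl
  existsUnique := by
    rintro (x | x') y h
    · exact ⟨x, ⟨rfl, Sum.inl_injective h⟩, fun _ h' => Sum.inl_injective h'.1⟩
    · exact absurd h Sum.inr_ne_inl

theorem isPullback_inr (f : X →[G] Y) (f' : X' →[G] Y') :
    IsPullback (inr X X') f' (sumMap f f') (inr Y Y') where
  comm _ := rfl
  existsUnique := by
    rintro (x | x') y h
    · exact absurd h Sum.inl_ne_inr
    · exact ⟨x', ⟨rfl, Sum.inr_injective h⟩, fun _ h' => Sum.inr_injective h'.1⟩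

theorem isPullback_of_injective {i : X →[G] Z} (hi : Function.Injective i) :
    IsPullback (MulActionHom.id G) (MulActionHom.id G) i i where
  comm _ := rfl
  existsUnique x _ h := ⟨x, ⟨rfl, hi h⟩, fun _ hw => hw.1⟩

theorem isPullback_of_disjoint {i : X →[G] Z} {j : Y →[G] Z} (h : ∀ x y, i x ≠ j y) :
    IsPullback (ofEmpty X) (ofEmpty Y) i j where
  comm w := w.elim
  existsUnique x y e := absurd e (h x y)

theorem isPullback_sumMap_fold (f : X →[G] Y) :
    IsPullback (sumMap f f) (fold X) (fold Y) f where
  comm := by rintro (x | x) <;> rfl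
  existsUnique := by
    rintro (y | y) x h
    · refine ⟨Sum.inl x, ⟨congrArg Sum.inl h.symm, rfl⟩, ?_⟩
      rintro (x' | x') ⟨h', h''⟩
      · exact congrArg Sum.inl h''
      · cases h'
    · refine ⟨Sum.inr x, ⟨congrArg Sum.inr h.symm, rfl⟩, ?_⟩
      rintro (x' | x') ⟨h', h''⟩
      · cases h'
      · exact congrArg Sum.inr h''

end Pullbacks

section Exponentials

open scoped Pointwise

variable {G : Type u} [Group G] {A X Y : FinGSet G}

theorem bijOn_smul_set {f : A →[G] X} {g : X →[G] Y} {t : Set A} {y : Y}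
    (h : Set.BijOn f t (g ⁻¹' {y})) (c : G) : Set.BijOn f (c • t) (g ⁻¹' {c • y}) := by
  have hg : g ⁻¹' {c • y} = c • g ⁻¹' {y} := by
    ext x
    rw [Set.mem_smul_set_iff_inv_smul_mem, Set.mem_preimage, Set.mem_preimage, map_smul,
      Set.mem_singleton_iff, Set.mem_singleton_iff, inv_smul_eq_iff]
  rw [hg]
  refine ⟨?_, ?_, ?_⟩
  · rintro _ ⟨a, ha, rfl⟩
    exact ⟨f a, h.mapsTo ha, (map_smul f c a).symm⟩
  · rintro _ ⟨a, ha, rfl⟩ _ ⟨b, hb, rfl⟩ hab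
    simp only [map_smul, smul_left_cancel_iff] at hab
    exact congrArg (c • ·) (h.injOn ha hb hab)
  · rintro _ ⟨x, hx, rfl⟩
    obtain ⟨a, ha, rfl⟩ := h.surjOn hx
    exact ⟨c • a, Set.smul_mem_smul_set ha, map_smul f c a⟩

/-- The dependent product `Π_g A` of `f : A → X` along `g : X → Y`. A section of `f` over the
fibre `g⁻¹(y)` is encoded by its image, a subset of `A` which `f` maps bijectively to `g⁻¹(y)`. -/
def dependentProduct (f : A →[G] X) (g : X →[G] Y) : SubMulAction G (Y × Set A) where
  carrier := {z | Set.BijOn f z.2 (g ⁻¹' {z.1})}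
  smul_mem' c _ h := bijOn_smul_set h c

/-- The source of the evaluation map of `Π_g A`: the sections with a point of their image. -/
def pointedSections (f : A →[G] X) (g : X →[G] Y) :
    SubMulAction G (A × dependentProduct f g) where
  carrier := {w | w.1 ∈ w.2.1.2}
  smul_mem' _ _ h := Set.smul_mem_smul_set h

variable {f : A →[G] X} {g : X →[G] Y}

theorem dependentProduct_existsUnique (y : Y) (s : {x // g x = y} → A) (hs : ∀ x, f (s x) = x.1) :
    ∃! z : dependentProduct f g, z.1.1 = y ∧
      ∀ a ∈ z.1.2, ∀ x : {x // g x = y}, f a = x.1 → a = s x := by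
  refine ⟨⟨(y, Set.range s), ?_, ?_, ?_⟩, ⟨rfl, ?_⟩, ?_⟩
  · rintro _ ⟨x, rfl⟩
    exact (congrArg g (hs x)).trans x.2
  · rintro _ ⟨x, rfl⟩ _ ⟨x', rfl⟩ h
    rw [hs, hs] at h
    rw [Subtype.ext h]
  · exact fun x hx => ⟨s ⟨x, hx⟩, ⟨_, rfl⟩, hs _⟩
  · rintro _ ⟨x', rfl⟩ x h
    rw [hs] at h
    rw [Subtype.ext h]
  · rintro ⟨⟨y, t⟩, ht : Set.BijOn f t (g ⁻¹' {y})⟩ ⟨rfl, h⟩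
    refine Subtype.ext (Prod.ext rfl (subset_antisymm ?_ ?_))
    · exact fun a ha => ⟨⟨f a, ht.mapsTo ha⟩, (h a ha _ rfl).symm⟩
    · rintro _ ⟨x, rfl⟩
      obtain ⟨a, ha, hax⟩ := ht.surjOn x.2
      exact h a ha x hax ▸ ha

theorem exists_isExponential (f : A →[G] X) (g : X →[G] Y) :
    ∃ (W P : FinGSet G) (e : W →[G] A) (p : W →[G] P) (q : P →[G] Y),
      IsExponential f g e p q := by
  let P := dependentProduct f g
  let W := pointedSections f g
  refine ⟨ofSubMulAction W, ofSubMulAction P, (MulActionHom.fst G A P).comp W.subtype,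
    (MulActionHom.snd G A P).comp W.subtype, (MulActionHom.fst G Y (Set A)).comp P.subtype,
    ⟨fun w => w.1.2.2.mapsTo w.2, fun x z h => ?_⟩, fun y s hs => ?_⟩
  · obtain ⟨a, ha, hax⟩ := z.2.surjOn h
    refine ⟨⟨(a, z), ha⟩, ⟨hax, rfl⟩, ?_⟩
    rintro ⟨⟨a', z'⟩, ha'⟩ ⟨hx, rfl : z' = z⟩
    exact Subtype.ext (Prod.ext (z'.2.injOn ha' ha (hx.trans hax.symm)) rfl)
  · refine (existsUnique_congr fun z => and_congr_right fun _ => ?_).1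
      (dependentProduct_existsUnique y s hs)
    constructor
    · rintro h ⟨⟨a, z⟩, ha⟩ x rfl hx
      exact h a ha x hx
    · exact fun h a ha x hx => h ⟨(a, z), ha⟩ x rfl hx

theorem isExponential_fold (f : X →[G] Y) :
    IsExponential (sumMap f (MulActionHom.id G)) (fold Y)
      (sumMap (MulActionHom.id G) f) (fold X) f where
  isPullback := by
    convert isPullback_sumMap_fold f
    ext (x | x) <;> rfl
  existsUnique y s hs := by
    obtain ⟨x, hx⟩ : ∃ x, s ⟨Sum.inl y, rfl⟩ = Sum.inl x := by
      rcases h : s ⟨Sum.inl y, rfl⟩ with x | y'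
      · exact ⟨x, rfl⟩
      · exact absurd (h ▸ hs ⟨Sum.inl y, rfl⟩) Sum.inr_ne_inl
    have hfx : f x = y := Sum.inl_injective (hx ▸ hs ⟨Sum.inl y, rfl⟩)
    subst hfx
    obtain ⟨y', hy'⟩ : ∃ y', s ⟨Sum.inr (f x), rfl⟩ = Sum.inr y' := by
      rcases h : s ⟨Sum.inr (f x), rfl⟩ with x' | y'
      · exact absurd (h ▸ hs ⟨Sum.inr (f x), rfl⟩) Sum.inl_ne_inr
      · exact ⟨y', rfl⟩
    obtain rfl : y' = f x := Sum.inr_injective (hy' ▸ hs ⟨Sum.inr (f x), rfl⟩)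
    refine ⟨x, ⟨rfl, ?_⟩, fun x' h => Sum.inl_injective (β := Y) ?_⟩
    · rintro (_ | _) ⟨_, _⟩ rfl rfl
      · exact hx.symm
      · exact hy'.symm
    · exact (h.2 (Sum.inl x') ⟨Sum.inl (f x), rfl⟩ rfl (congrArg Sum.inl h.1)).trans hx

end Exponentials

section Orbits

variable {G : Type u} [Group G] [Finite G]

/-- The coset of the identity in `G/H`. -/
def base (H : Subgroup G) : orbit H := (QuotientGroup.mk 1 : G ⧸ H)

instance (H : Subgroup G) : Nonempty (orbit H) := ⟨base H⟩

theorem exists_smul_eq {H : Subgroup G} (x y : orbit H) : ∃ g : G, g • x = y :=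
  MulAction.exists_smul_eq (α := G ⧸ H) G x y

theorem surjective_of_orbit {X : FinGSet G} [Nonempty X] {H : Subgroup G} (f : X →[G] orbit H) :
    Function.Surjective f := by
  intro y
  obtain ⟨x⟩ := ‹Nonempty X›
  obtain ⟨g, hg⟩ := exists_smul_eq (f x) y
  exact ⟨g • x, by rw [map_smul, hg]⟩

/-- The map `G/Gₓ → X`, `g ↦ g x`, which identifies `G/Gₓ` with the orbit of `x`. -/
def orbitMap {X : FinGSet G} (x : X) : orbit (MulAction.stabilizer G x) →[G] X where
  toFun := MulAction.ofQuotientStabilizer G x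
  map_smul' := MulAction.ofQuotientStabilizer_smul G x

theorem orbitMap_injective {X : FinGSet G} (x : X) : Function.Injective (orbitMap x) :=
  MulAction.injective_ofQuotientStabilizer G x

theorem orbitMap_base {X : FinGSet G} (x : X) : orbitMap x (base _) = x := one_smul G x

theorem exists_orbit_decomposition {X : FinGSet G} (x : X) :
    ∃ (Y : FinGSet G) (j : Y →[G] X),
      Function.Bijective (Sum.elim (orbitMap x) j) ∧ Nat.card Y < Nat.card X := by
  let s : SubMulAction G X :=
    { carrier := (Set.range (orbitMap x))ᶜ
      smul_mem' := fun g y hy ⟨c, hc⟩ =>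
        hy ⟨g⁻¹ • c, by rw [map_smul, hc, inv_smul_smul]⟩ }
  refine ⟨ofSubMulAction s, s.subtype, ⟨?_, fun y => ?_⟩, ?_⟩
  · exact (orbitMap_injective x).sumElim Subtype.val_injective fun c y h => y.2 ⟨c, h⟩
  · by_cases hy : y ∈ Set.range (orbitMap x)
    · obtain ⟨c, rfl⟩ := hy
      exact ⟨Sum.inl c, rfl⟩
    · exact ⟨Sum.inr ⟨y, hy⟩, rfl⟩
  · exact Set.ncard_lt_card (s := (s : Set X)) fun h =>
      (h ▸ Set.mem_univ x : x ∈ (s : Set X)) ⟨base _, orbitMap_base x⟩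

theorem induction_on_orbits {P : FinGSet G → Prop} (empty : ∀ X : FinGSet G, IsEmpty X → P X)
    (orbit_sum : ∀ {X Y : FinGSet G} (x : X) (j : Y →[G] X),
      Function.Bijective (Sum.elim (orbitMap x) j) → P Y → P X) (X : FinGSet G) : P X := by
  induction hn : Nat.card X using Nat.strong_induction_on generalizing X with
  | _ n ih =>
    rcases isEmpty_or_nonempty X with hX | ⟨⟨x⟩⟩
    · exact empty X hX
    · obtain ⟨Y, j, hj, hlt⟩ := exists_orbit_decomposition x
      exact orbit_sum x j hj (ih _ (hn ▸ hlt) Y rfl)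

end Orbits

end FinGSet

namespace TambaraFunctor

section Identities

variable {G : Type u} [Group G] (R : TambaraFunctor.{u, v} G) {W X X' Y Z : FinGSet G}

theorem res_tr_of_injective {i : X →[G] Z} (hi : Function.Injective i) (a : R.obj X) :
    R.res i (R.tr i a) = a := by
  rw [R.res_tr (isPullback_of_injective hi), R.res_id, R.tr_id]

theorem res_nm_of_injective {i : X →[G] Z} (hi : Function.Injective i) (a : R.obj X) :
    R.res i (R.nm i a) = a := by
  rw [R.res_nm (isPullback_of_injective hi), R.res_id, R.nm_id]

theorem subsingleton_obj_emptyGSet : Subsingleton (R.obj emptyGSet) :=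
  R.subsingleton_of_isEmpty _ (inferInstanceAs (IsEmpty PEmpty))

theorem res_tr_of_disjoint {i : X →[G] Z} {j : Y →[G] Z} (h : ∀ x y, i x ≠ j y) (a : R.obj X) :
    R.res j (R.tr i a) = 0 := by
  have := R.subsingleton_obj_emptyGSet
  rw [R.res_tr (isPullback_of_disjoint h), Subsingleton.elim (R.res _ a) 0, map_zero]

theorem res_nm_of_disjoint {i : X →[G] Z} {j : Y →[G] Z} (h : ∀ x y, i x ≠ j y) (a : R.obj X) :
    R.res j (R.nm i a) = 1 := by
  have := R.subsingleton_obj_emptyGSet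
  rw [R.res_nm (isPullback_of_disjoint h), Subsingleton.elim (R.res _ a) 1, map_one]

section Decomposition

variable {i : X →[G] Z} {j : X' →[G] Z} (h : Function.Bijective (Sum.elim i j))
include h

theorem tr_res_add_tr_res (a : R.obj Z) : R.tr i (R.res i a) + R.tr j (R.res j a) = a := by
  obtain ⟨hi, hj, hij⟩ := Sum.elim_injective.1 h.1
  refine (R.coprod_bijective i j h).1 (Prod.ext ?_ ?_) <;> dsimp only
  · rw [map_add, R.res_tr_of_injective hi, R.res_tr_of_disjoint fun y x => (hij x y).symm,
      add_zero]
  · rw [map_add, R.res_tr_of_injective hj, R.res_tr_of_disjoint hij, zero_add]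

theorem nm_res_mul_nm_res (a : R.obj Z) : R.nm i (R.res i a) * R.nm j (R.res j a) = a := by
  obtain ⟨hi, hj, hij⟩ := Sum.elim_injective.1 h.1
  refine (R.coprod_bijective i j h).1 (Prod.ext ?_ ?_) <;> dsimp only
  · rw [map_mul, R.res_nm_of_injective hi, R.res_nm_of_disjoint fun y x => (hij x y).symm,
      mul_one]
  · rw [map_mul, R.res_nm_of_injective hj, R.res_nm_of_disjoint hij, one_mul]

theorem tr_eq_add (f : Z →[G] Y) (a : R.obj Z) :
    R.tr f a = R.tr (f.comp i) (R.res i a) + R.tr (f.comp j) (R.res j a) := by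
  rw [R.tr_comp, R.tr_comp, ← map_add, R.tr_res_add_tr_res h]

theorem nm_eq_mul (f : Z →[G] Y) (a : R.obj Z) :
    R.nm f a = R.nm (f.comp i) (R.res i a) * R.nm (f.comp j) (R.res j a) := by
  rw [R.nm_comp, R.nm_comp, ← map_mul, R.nm_res_mul_nm_res h]

end Decomposition

theorem exists_res_inl_res_inr (a : R.obj X) (b : R.obj Y) :
    ∃ c : R.obj (coprod X Y), R.res (inl X Y) c = a ∧ R.res (inr X Y) c = b :=
  ((R.coprod_bijective _ _ (bijective_inl_inr X Y)).2 (a, b)).imp fun _ => Prod.ext_iff.1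

theorem nm_fold (a : R.obj (coprod X X)) :
    R.nm (fold X) a = R.res (inl X X) a * R.res (inr X X) a := by
  rw [R.nm_eq_mul (bijective_inl_inr X X)]
  exact congrArg₂ (· * ·) (R.nm_id _) (R.nm_id _)

theorem tr_mul (f : X →[G] Y) (a : R.obj X) (b : R.obj Y) :
    R.tr f a * b = R.tr f (a * R.res f b) := by
  obtain ⟨c, rfl, rfl⟩ := R.exists_res_inl_res_inr a b
  have h := R.nm_tr (isExponential_fold f) c
  rw [nm_fold, nm_fold, R.res_tr (isPullback_inl _ _), R.res_tr (isPullback_inr _ _),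
    R.tr_id, ← R.res_comp, ← R.res_comp] at h
  rw [← R.res_comp]
  exact h

theorem tr_mul_tr {p : W →[G] X} {q : W →[G] Y} {f : X →[G] Z} {g : Y →[G] Z}
    (h : IsPullback p q f g) (a : R.obj X) (b : R.obj Y) :
    R.tr f a * R.tr g b = R.tr (f.comp p) (R.res p a * R.res q b) := by
  rw [R.tr_mul, R.res_tr h.symm, mul_comm, R.tr_mul, ← R.tr_comp, mul_comm]

end Identities

namespace TambaraIdeal

variable {G : Type u} [Group G] [Finite G] {R : TambaraFunctor.{u, v} G}

theorem sInf_le {s : Set (TambaraIdeal R)} {I : TambaraIdeal R} (h : I ∈ s) : sInf s ≤ I :=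
  fun _ => iInf₂_le I h

theorem mem_sInf {s : Set (TambaraIdeal R)} {H : Subgroup G} {a : R.obj (orbit H)} :
    a ∈ (sInf s).ideal H ↔ ∀ I ∈ s, a ∈ I.ideal H := by
  simp only [sInf, Submodule.mem_iInf]

theorem mul_le {I J K : TambaraIdeal R}
    (h : ∀ H, ∀ a ∈ I.ideal H, ∀ b ∈ J.ideal H, a * b ∈ K.ideal H) : I * J ≤ K :=
  sInf_le fun H => Ideal.mul_le.2 (h H)

theorem mul_mem_mul {I J : TambaraIdeal R} {H : Subgroup G} {a b : R.obj (orbit H)}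
    (ha : a ∈ I.ideal H) (hb : b ∈ J.ideal H) : a * b ∈ (I * J).ideal H :=
  mem_sInf.2 fun _ hL => hL H (Ideal.mul_mem_mul ha hb)

/-- The extension of a Tambara ideal to all finite `G`-sets: `p.extend X` consists of the elements
of `R(X)` whose restrictions along all maps `G/K → X` lie in `p`. -/
def extend (p : TambaraIdeal R) (X : FinGSet G) : Ideal (R.obj X) :=
  ⨅ (K : Subgroup G) (k : orbit K →[G] X), (p.ideal K).comap (R.res k)

variable {p : TambaraIdeal R} {X Y : FinGSet G} {H : Subgroup G}

theorem mem_extend {a : R.obj X} :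
    a ∈ p.extend X ↔ ∀ (K : Subgroup G) (k : orbit K →[G] X), R.res k a ∈ p.ideal K := by
  simp only [extend, Submodule.mem_iInf, Ideal.mem_comap]

theorem res_mem_extend (f : X →[G] Y) {a : R.obj Y} (h : a ∈ p.extend Y) :
    R.res f a ∈ p.extend X :=
  mem_extend.2 fun K k => R.res_comp f k a ▸ mem_extend.1 h K (f.comp k)

theorem tr_mem_of_mem_extend (f : X →[G] orbit H) {a : R.obj X} (h : a ∈ p.extend X) :
    R.tr f a ∈ p.ideal H := by
  induction X using induction_on_orbits with
  | empty X hX =>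
    have := R.subsingleton_of_isEmpty X hX
    rw [Subsingleton.elim a 0, map_zero]
    exact (p.ideal H).zero_mem
  | orbit_sum x j hj ih =>
    rw [R.tr_eq_add hj]
    exact (p.ideal H).add_mem (p.tr_mem _ (mem_extend.1 h _ _)) (ih _ (res_mem_extend j h))

theorem nm_mem_of_res_orbitMap_mem (f : X →[G] orbit H) {a : R.obj X} (x : X)
    (h : R.res (orbitMap x) a ∈ p.ideal _) : R.nm f a ∈ p.ideal H := by
  obtain ⟨Y, j, hj, -⟩ := exists_orbit_decomposition x
  rw [R.nm_eq_mul hj]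
  exact Ideal.mul_mem_right _ _ (p.nm_mem _ h)

end TambaraIdeal

section FibreNorms

variable {G : Type u} [Group G] {R : TambaraFunctor.{u, v} G} {A B Z : FinGSet G}

/-- The norms along `v` of restrictions along `w` of a fixed element `a ∈ R(Z)`, for all diagrams
`A ←v- X -w→ Z` such that all fibres of `v` have at least `m` points. -/
def fibreNorms (a : R.obj Z) (m : ℕ) (A : FinGSet G) : Set (R.obj A) :=
  {b | ∃ (X : FinGSet G) (v : X →[G] A) (w : X →[G] Z),
    (∀ s, m ≤ Nat.card {x // v x = s}) ∧ R.nm v (R.res w a) = b}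

variable {a : R.obj Z} {m k : ℕ}

theorem fibreNorms_anti (h : m ≤ k) : fibreNorms a k A ⊆ fibreNorms a m A := by
  rintro _ ⟨X, v, w, hv, rfl⟩
  exact ⟨X, v, w, fun s => h.trans (hv s), rfl⟩

theorem self_mem_fibreNorms_one (a : R.obj Z) : a ∈ fibreNorms a 1 Z :=
  ⟨Z, MulActionHom.id G, MulActionHom.id G,
    fun s => Nat.card_pos_iff.2 ⟨⟨s, rfl⟩, inferInstance⟩, by rw [R.res_id, R.nm_id]⟩

theorem res_mem_fibreNorms (f : A →[G] B) {b : R.obj B} (hb : b ∈ fibreNorms a m B) :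
    R.res f b ∈ fibreNorms a m A := by
  obtain ⟨X, v, w, hv, rfl⟩ := hb
  obtain ⟨W, p, q, h⟩ := exists_isPullback v f
  exact ⟨W, q, w.comp p, fun s => (hv _).trans_eq (h.card_fibre s).symm, by
    rw [R.res_nm h, R.res_comp]⟩

theorem nm_mem_fibreNorms {f : A →[G] B} (hf : Function.Surjective f) {b : R.obj A}
    (hb : b ∈ fibreNorms a m A) : R.nm f b ∈ fibreNorms a m B := by
  obtain ⟨X, v, w, hv, rfl⟩ := hb
  refine ⟨X, f.comp v, w, fun s => ?_, R.nm_comp f v _⟩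
  obtain ⟨t, rfl⟩ := hf s
  exact (hv t).trans (Nat.card_mono (Set.toFinite {x | f (v x) = f t}) fun _ => congrArg f)

theorem exists_mem_fibreNorms_coprod {b : R.obj A} {c : R.obj B} (hb : b ∈ fibreNorms a m A)
    (hc : c ∈ fibreNorms a m B) :
    ∃ d ∈ fibreNorms a m (coprod A B), R.res (inl A B) d = b ∧ R.res (inr A B) d = c := by
  obtain ⟨X, v, w, hv, rfl⟩ := hb
  obtain ⟨X', v', w', hv', rfl⟩ := hc
  refine ⟨_, ⟨coprod X X', sumMap v v', copair w w', ?_, rfl⟩, ?_, ?_⟩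
  · rintro (s | s)
    · exact (hv s).trans_eq ((isPullback_inl v v').card_fibre s)
    · exact (hv' s).trans_eq ((isPullback_inr v v').card_fibre s)
  · rw [R.res_nm (isPullback_inl v v'), ← R.res_comp]
    rfl
  · rw [R.res_nm (isPullback_inr v v'), ← R.res_comp]
    rfl

theorem mul_mem_fibreNorms {b c : R.obj A} (hb : b ∈ fibreNorms a m A)
    (hc : c ∈ fibreNorms a k A) : b * c ∈ fibreNorms a (m + k) A := by
  obtain ⟨X, v, w, hv, rfl⟩ := hb
  obtain ⟨X', v', w', hv', rfl⟩ := hc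
  refine ⟨coprod X X', copair v v', copair w w', fun s => ?_, ?_⟩
  · rw [card_fibre_eq_add (bijective_inl_inr X X')]
    exact add_le_add (hv s) (hv' s)
  · rw [R.nm_eq_mul (bijective_inl_inr X X'), ← R.res_comp, ← R.res_comp]
    rfl

end FibreNorms

section FibreNormIdeal

variable {G : Type u} [Group G] [Finite G] {R : TambaraFunctor.{u, v} G}

/-- The Tambara ideal generated by the sets `fibreNorms a m (G/H)`. Its elements are the transfers
of multiples of elements of `fibreNorms a m X`, for all finite `G`-sets `X`. -/
def fibreNormIdeal {Z : FinGSet G} (a : R.obj Z) (m : ℕ) : TambaraIdeal R where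
  ideal H :=
    { carrier := {b | ∃ (X : FinGSet G) (u : X →[G] orbit H) (c y : R.obj X),
        y ∈ fibreNorms a m X ∧ R.tr u (c * y) = b}
      zero_mem' := ⟨emptyGSet, ofEmpty _, 0, _,
        ⟨emptyGSet, MulActionHom.id G, ofEmpty Z, fun s => s.elim, rfl⟩, by
          rw [zero_mul, map_zero]⟩
      add_mem' := by
        rintro _ _ ⟨X, u, c, y, hy, rfl⟩ ⟨X', u', c', y', hy', rfl⟩
        obtain ⟨z, hz, rfl, rfl⟩ := exists_mem_fibreNorms_coprod hy hy'
        obtain ⟨d, rfl, rfl⟩ := R.exists_res_inl_res_inr c c'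
        refine ⟨coprod X X', copair u u', d, z, hz, ?_⟩
        rw [R.tr_eq_add (bijective_inl_inr X X'), map_mul (R.res _), map_mul (R.res _)]
        rfl
      smul_mem' := by
        rintro r _ ⟨X, u, c, y, hy, rfl⟩
        refine ⟨X, u, c * R.res u r, y, hy, ?_⟩
        rw [smul_eq_mul, mul_comm r, R.tr_mul, mul_right_comm] }
  res_mem := by
    rintro K H f _ ⟨X, u, c, y, hy, rfl⟩
    obtain ⟨W, p, q, h⟩ := exists_isPullback u f
    exact ⟨W, q, R.res p c, R.res p y, res_mem_fibreNorms p hy, by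
      rw [R.res_tr h, map_mul (R.res p)]⟩
  tr_mem := by
    rintro K H f _ ⟨X, u, c, y, hy, rfl⟩
    exact ⟨X, f.comp u, c, y, hy, R.tr_comp f u _⟩
  nm_mem := by
    rintro K H f _ ⟨X, u, c, y, hy, rfl⟩
    obtain ⟨W, P, e, p, q, h⟩ := exists_isExponential u f
    have hp : Function.Surjective p := h.isPullback.surjective (surjective_of_orbit f)
    exact ⟨P, q, R.nm p (R.res e c), R.nm p (R.res e y),
      nm_mem_fibreNorms hp (res_mem_fibreNorms e hy), by
        rw [R.nm_tr h, map_mul (R.res e), map_mul (R.nm p)]⟩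

variable {Z : FinGSet G} {a : R.obj Z} {m k : ℕ}

theorem mem_fibreNormIdeal {H : Subgroup G} {b : R.obj (orbit H)}
    (hb : b ∈ fibreNorms a m (orbit H)) : b ∈ (fibreNormIdeal a m).ideal H :=
  ⟨orbit H, MulActionHom.id G, 1, b, hb, by rw [one_mul, R.tr_id]⟩

theorem fibreNormIdeal_le {p : TambaraIdeal R}
    (h : ∀ H, ∀ b ∈ fibreNorms a m (orbit H), b ∈ p.ideal H) : fibreNormIdeal a m ≤ p := by
  rintro H _ ⟨X, u, c, y, hy, rfl⟩
  refine TambaraIdeal.tr_mem_of_mem_extend u (Ideal.mul_mem_left _ c ?_)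
  exact TambaraIdeal.mem_extend.2 fun K k => h K _ (res_mem_fibreNorms k hy)

theorem fibreNormIdeal_mul_le (a : R.obj Z) (m k : ℕ) :
    fibreNormIdeal a m * fibreNormIdeal a k ≤ fibreNormIdeal a (m + k) := by
  refine TambaraIdeal.mul_le ?_
  rintro H _ ⟨X, u, c, y, hy, rfl⟩ _ ⟨X', u', c', y', hy', rfl⟩
  obtain ⟨W, p, q, hW⟩ := exists_isPullback u u'
  refine ⟨W, u.comp p, R.res p c * R.res q c', R.res p y * R.res q y',
    mul_mem_fibreNorms (res_mem_fibreNorms p hy) (res_mem_fibreNorms q hy'), ?_⟩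
  rw [R.tr_mul_tr hW, map_mul (R.res p), map_mul (R.res q), mul_mul_mul_comm]

theorem TambaraIdeal.IsPrime.mem_of_fibreNormIdeal_le {p : TambaraIdeal R} (hp : p.IsPrime)
    {H : Subgroup G} {a : R.obj (orbit H)} (m : ℕ) (h : fibreNormIdeal a m ≤ p) :
    a ∈ p.ideal H := by
  have ha := self_mem_fibreNorms_one a
  induction m with
  | zero => exact h H (mem_fibreNormIdeal (fibreNorms_anti zero_le_one ha))
  | succ m ih =>
    rcases hp.le_or_le _ _ ((fibreNormIdeal_mul_le a m 1).trans h) with h' | h'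
    · exact ih h'
    · exact h' H (mem_fibreNormIdeal ha)

end FibreNormIdeal

section NormResEqPow

variable {G : Type u} [Group G] [Finite G]

/-- The composite of restriction and norm along a map `f : G/K → G/H` is the power map whose
exponent is the cardinality of the fibres of `f`. This is the multiplicative half of the condition
which defines cohomological Tambara functors; it is what the description of the Nakaoka spectrum
uses about injectivity of restrictions. -/
def NormResEqPow (R : TambaraFunctor.{u, v} G) : Prop :=
  ∀ ⦃K H : Subgroup G⦄ (f : orbit K →[G] orbit H) (a : R.obj (orbit H)) (y : orbit H),
    R.nm f (R.res f a) = a ^ Nat.card {x // f x = y}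

theorem fibreProd_comp_eq_pow {X Y : Type u} [Finite X] {M : Type v} [CommMonoid M]
    (f : X → Y) (a : Y → M) (y : Y) :
    fibreProd f (fun x => a (f x)) y = a y ^ Nat.card {x // f x = y} := by
  have := Fintype.ofFinite {x // f x = y}
  have ha : (fun x : {x // f x = y} => a (f x.1)) = fun _ => a y :=
    funext fun x => congrArg a x.2
  rw [fibreProd, ha, finprod_eq_prod_of_fintype, Finset.prod_const, Finset.card_univ,
    Nat.card_eq_fintype_card]

theorem fixedPoint_normResEqPow (S : Type v) [CommRing S] [MulSemiringAction G S] :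
    (fixedPoint G S).NormResEqPow := by
  intro K H f a y
  refine Subtype.ext (funext fun y' => ?_)
  obtain ⟨g, rfl⟩ := exists_smul_eq y y'
  rw [← card_fibre_smul f g y]
  exact fibreProd_comp_eq_pow f a.1 (g • y)

variable {R : TambaraFunctor.{u, v} G} {S : TambaraFunctor.{u, w} G}

theorem NormResEqPow.of_injective (hS : S.NormResEqPow) (φ : Hom R S)
    (hφ : ∀ H : Subgroup G, Function.Injective (φ.app (orbit H))) : R.NormResEqPow := by
  intro K H f a y
  apply hφ
  rw [φ.app_nm, φ.app_res, hS, map_pow]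

theorem NormResEqPow.of_res_injective
    (hR : ∀ (K H : Subgroup G) (f : orbit K →[G] orbit H), Function.Injective (R.res f)) :
    R.NormResEqPow :=
  (fixedPoint_normResEqPow R.bottom).of_injective R.unit fun H _ _ h =>
    hR _ _ (pointMap (base H)) (congrFun (congrArg Subtype.val h) (base H))

theorem NormResEqPow.nm_res (hR : R.NormResEqPow) {X : FinGSet G} {H : Subgroup G}
    (f : X →[G] orbit H) (a : R.obj (orbit H)) (y : orbit H) :
    R.nm f (R.res f a) = a ^ Nat.card {x // f x = y} := by
  induction X using induction_on_orbits with
  | empty X hX =>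
    have := R.subsingleton_of_isEmpty X hX
    rw [Subsingleton.elim (R.res f a) 1, map_one, Nat.card_of_isEmpty, pow_zero]
  | orbit_sum x j hj ih =>
    rw [R.nm_eq_mul hj, card_fibre_eq_add hj, pow_add, ← R.res_comp, ← R.res_comp,
      hR (f.comp (orbitMap x)) a y, ih]
    rfl

theorem NormResEqPow.res_orbitMap_nm_res (hR : R.NormResEqPow) {X Z : FinGSet G}
    (f : X →[G] Z) (a : R.obj Z) (z : Z) :
    R.res (orbitMap z) (R.nm f (R.res f a)) =
      R.res (orbitMap z) a ^ Nat.card {x // f x = z} := by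
  obtain ⟨W, p, q, h⟩ := exists_isPullback f (orbitMap z)
  have hpq : f.comp p = (orbitMap z).comp q := MulActionHom.ext h.comm
  rw [R.res_nm h, ← R.res_comp, hpq, R.res_comp, hR.nm_res q _ (base _), h.card_fibre,
    orbitMap_base]

end NormResEqPow

section Radical

theorem exists_le_card_and_of_card_mul_le {X A B : Type u} [Finite X] [Finite B] [Nonempty B]
    {v : X → A} (w : X → B) {a : A} {n : ℕ} (h : Nat.card B * n ≤ Nat.card {x // v x = a}) :
    ∃ b, n ≤ Nat.card {x // v x = a ∧ w x = b} := by
  classical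
  have := Fintype.ofFinite X
  have := Fintype.ofFinite B
  simp only [Nat.card_eq_fintype_card, Fintype.card_subtype] at h ⊢
  obtain ⟨b, -, hb⟩ := Finset.exists_le_card_fiber_of_mul_le_card_of_maps_to (f := w)
    (fun _ _ => Finset.mem_univ _) Finset.univ_nonempty h
  exact ⟨b, by rwa [Finset.filter_filter] at hb⟩

variable {G : Type u} [Group G] [Finite G] {R : TambaraFunctor.{u, v} G} {H : Subgroup G}

theorem NormResEqPow.mem_of_mem_fibreNorms (hR : R.NormResEqPow) {p : TambaraIdeal R}
    {a : R.obj (orbit H)} {n : ℕ} (ha : a ^ n ∈ p.ideal H) {K : Subgroup G}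
    {b : R.obj (orbit K)} (hb : b ∈ fibreNorms a (Nat.card (orbit H) * n) (orbit K)) :
    b ∈ p.ideal K := by
  obtain ⟨X, v, w, hv, rfl⟩ := hb
  obtain ⟨y, hy⟩ := exists_le_card_and_of_card_mul_le w (hv (base K))
  let pr₁ : prod (orbit K) (orbit H) →[G] orbit K := MulActionHom.fst G _ _
  let pr₂ : prod (orbit K) (orbit H) →[G] orbit H := MulActionHom.snd G _ _
  let r : X →[G] prod (orbit K) (orbit H) := v.prod w
  let z : prod (orbit K) (orbit H) := (base K, y)
  have hz : n ≤ Nat.card {x // r x = z} :=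
    hy.trans (Nat.card_mono (Set.toFinite {x | r x = z}) fun _ hx => Prod.ext hx.1 hx.2)
  change R.nm (pr₁.comp r) (R.res (pr₂.comp r) a) ∈ p.ideal K
  rw [R.nm_comp, R.res_comp]
  refine TambaraIdeal.nm_mem_of_res_orbitMap_mem pr₁ z ?_
  rw [hR.res_orbitMap_nm_res, ← R.res_comp, ← map_pow]
  exact p.res_mem _ (Ideal.pow_mem_of_pow_mem _ ha hz)

theorem TambaraIdeal.IsPrime.isRadical {p : TambaraIdeal R} (hp : p.IsPrime)
    (hR : R.NormResEqPow) (H : Subgroup G) : (p.ideal H).IsRadical := by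
  rintro a ⟨n, ha⟩
  exact hp.mem_of_fibreNormIdeal_le (Nat.card (orbit H) * n)
    (fibreNormIdeal_le fun _ _ => hR.mem_of_mem_fibreNorms ha)

end Radical

section InvariantTheory

instance isInvariant_fixedPoints_subring {G : Type u} [Group G] {S : Type v} [CommRing S]
    [MulSemiringAction G S] : Algebra.IsInvariant (FixedPoints.subring S G) S G where
  isInvariant b hb := ⟨⟨b, hb⟩, rfl⟩

theorem mem_radical_of_under_le {A B G : Type*} [CommRing A] [CommRing B] [Algebra A B] [Group G]
    [Finite G] [MulSemiringAction G B] [SMulCommClass G A B] [Algebra.IsInvariant A B G]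
    {I J : Ideal B} (h : I.under A ≤ J.under A) {b : B} (hb : ∀ g : G, g • b ∈ I) :
    b ∈ J.radical := by
  have := Algebra.IsInvariant.isIntegral A B G
  rw [Ideal.radical_eq_sInf, Submodule.mem_sInf]
  rintro P ⟨hJP, hP⟩
  obtain ⟨Q, hIQ, hQ, hQP⟩ := Ideal.exists_ideal_over_prime_of_isIntegral (Ideal.under A P) I
    (h.trans (Ideal.comap_mono hJP))
  obtain ⟨g, rfl⟩ := Algebra.IsInvariant.exists_smul_of_under_eq A B G Q P hQP
  exact Ideal.mem_pointwise_smul_iff_inv_smul_mem.2 (hIQ (hb g⁻¹))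

end InvariantTheory

section Eval

variable {G : Type u} [Group G] [Finite G] (R : TambaraFunctor.{u, v} G) {X Y : FinGSet G}

/-- The value at a point `x` of a finite `G`-set `X` of an element of `R(X)`, that is, its
restriction along the map `G/e → X`, `g ↦ g x`. It is the value at `x` of its image under the unit
`R → FP(R(G/e))`. -/
def eval (x : X) : R.obj X →+* R.bottom := R.res (pointMap x)

theorem eval_res (f : X →[G] Y) (a : R.obj Y) (x : X) :
    R.eval x (R.res f a) = R.eval (f x) a := by
  rw [eval, ← R.res_comp, comp_pointMap, eval]

theorem eval_tr (f : X →[G] Y) (a : R.obj X) (y : Y) :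
    R.eval y (R.tr f a) = fibreSum f (fun x => R.eval x a) y :=
  congrFun (congrArg Subtype.val (R.unit.app_tr f a)) y

theorem eval_nm (f : X →[G] Y) (a : R.obj X) (y : Y) :
    R.eval y (R.nm f a) = fibreProd f (fun x => R.eval x a) y :=
  congrFun (congrArg Subtype.val (R.unit.app_nm f a)) y

theorem eval_elt (g : G) (a : R.bottom) : R.eval (elt g) a = g • a := rfl

theorem eval_elt_one (a : R.bottom) : R.eval (elt (1 : G)) a = a := by
  rw [eval_elt, one_smul]

theorem eval_fixedPoint (s : FixedPoints.subring R.bottom G) (x : orbit (⊥ : Subgroup G)) :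
    R.eval x (s : R.bottom) = s := by
  obtain ⟨g, rfl⟩ := exists_elt x
  exact s.2 g

theorem unit_app_bot_bijective :
    Function.Bijective (R.unit.app (orbit (⊥ : Subgroup G))) := by
  refine ⟨fun a b h => ?_, fun b => ⟨b.1 (elt 1), Subtype.ext (funext fun x => ?_)⟩⟩
  · rw [← R.eval_elt_one a, ← R.eval_elt_one b]
    exact congrFun (congrArg Subtype.val h) (elt 1)
  · obtain ⟨g, rfl⟩ := exists_elt x
    change g • b.1 (elt 1) = b.1 (elt g)
    rw [← b.2, smul_elt, mul_one]

end Eval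

section Induced

theorem fibreSum_mem {X Y : Type u} {M : Type v} [AddCommMonoid M] (I : AddSubmonoid M) {f : X → Y}
    {a : X → M} (h : ∀ x, a x ∈ I) (y : Y) : fibreSum f a y ∈ I :=
  finsum_induction (· ∈ I) I.zero_mem (fun _ _ => I.add_mem) fun x => h x.1

theorem fibreProd_apply_mem {X Y : Type u} [Finite X] {M : Type v} [CommRing M] (I : Ideal M)
    {f : X → Y} {a : X → M} {x : X} (h : a x ∈ I) : fibreProd f a (f x) ∈ I := by
  have := Fintype.ofFinite {x' // f x' = f x}
  rw [fibreProd, finprod_eq_prod_of_fintype]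
  exact Ideal.prod_mem I (i := ⟨x, rfl⟩) (Finset.mem_univ _) h

variable {G : Type u} [Group G] [Finite G] {R : TambaraFunctor.{u, v} G}

/-- The largest Tambara ideal which is contained at the level `G/e` in a given ideal `I` of
`R(G/e)`. It consists of the elements all of whose values lie in `I`. -/
def induced (I : Ideal R.bottom) : TambaraIdeal R where
  ideal H := ⨅ x : orbit H, I.comap (R.eval x)
  res_mem f a ha := by
    simp only [Submodule.mem_iInf, Ideal.mem_comap, eval_res] at ha ⊢
    exact fun x => ha _
  tr_mem f a ha := by
    simp only [Submodule.mem_iInf, Ideal.mem_comap, eval_tr] at ha ⊢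
    exact fibreSum_mem I.toAddSubmonoid ha
  nm_mem f a ha := by
    simp only [Submodule.mem_iInf, Ideal.mem_comap, eval_nm] at ha ⊢
    intro y
    obtain ⟨x, rfl⟩ := surjective_of_orbit f y
    exact fibreProd_apply_mem I (ha x)

variable {I J : Ideal R.bottom} {p : TambaraIdeal R} {H : Subgroup G}

theorem mem_induced {a : R.obj (orbit H)} : a ∈ (induced I).ideal H ↔ ∀ x, R.eval x a ∈ I := by
  simp only [induced, Submodule.mem_iInf, Ideal.mem_comap]

theorem induced_mono (h : I ≤ J) : induced I ≤ induced J :=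
  fun _ _ ha => mem_induced.2 fun x => h (mem_induced.1 ha x)

theorem le_induced_iff : p ≤ induced I ↔ p.ideal ⊥ ≤ I := by
  refine ⟨fun h a ha => ?_, fun h H a ha => mem_induced.2 fun x => h (p.res_mem _ ha)⟩
  rw [← R.eval_elt_one a]
  exact mem_induced.1 (h ⊥ ha) (elt 1)

theorem fixedPoint_mem_induced {s : FixedPoints.subring R.bottom G} :
    (s : R.bottom) ∈ (induced I).ideal ⊥ ↔ (s : R.bottom) ∈ I := by
  simp only [mem_induced, eval_fixedPoint]
  exact ⟨fun h => h (elt 1), fun h _ => h⟩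

theorem induced_mul_le (I J : Ideal R.bottom) : induced I * induced J ≤ induced (I * J) := by
  refine TambaraIdeal.mul_le fun H a ha b hb => mem_induced.2 fun x => ?_
  rw [map_mul]
  exact Ideal.mul_mem_mul (mem_induced.1 ha x) (mem_induced.1 hb x)

theorem isPrime_induced (P : Ideal R.bottom) [hP : P.IsPrime] : (induced P).IsPrime where
  isProper := ⟨⊥, fun h => hP.ne_top (top_le_iff.1 (h ▸ le_induced_iff.1 le_rfl))⟩
  le_or_le I J h := by
    simp only [le_induced_iff] at h ⊢
    exact hP.mul_le.1 ((Ideal.mul_le.2 fun _ ha _ hb => TambaraIdeal.mul_mem_mul ha hb).trans h)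

end Induced

namespace TambaraIdeal.IsPrime

variable {G : Type u} [Group G] [Finite G] {R : TambaraFunctor.{u, v} G} {p q : TambaraIdeal R}

theorem mem_of_eval_mem (hp : p.IsPrime) (hR : R.NormResEqPow) {H : Subgroup G}
    {a : R.obj (orbit H)} {x : orbit H} (h : R.eval x a ∈ p.ideal ⊥) : a ∈ p.ideal H := by
  refine hp.isRadical hR H ⟨Nat.card {y // pointMap x y = x}, ?_⟩
  rw [← hR]
  exact p.nm_mem _ h

theorem ideal_bot_ne_top (hp : p.IsPrime) (hR : R.NormResEqPow) : p.ideal ⊥ ≠ ⊤ := by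
  obtain ⟨H, hH⟩ := hp.isProper
  refine fun h => hH (eq_top_iff.2 fun a _ => hp.mem_of_eval_mem hR (x := base H) ?_)
  rw [h]
  trivial

theorem induced_ideal_bot (hp : p.IsPrime) (hR : R.NormResEqPow) : induced (p.ideal ⊥) = p :=
  le_antisymm (fun H _ ha => hp.mem_of_eval_mem hR (mem_induced.1 ha (base H)))
    (le_induced_iff.2 le_rfl)

theorem le_of_under_le (hq : q.IsPrime) (hR : R.NormResEqPow)
    (h : (p.ideal ⊥).under (FixedPoints.subring R.bottom G) ≤
      (q.ideal ⊥).under (FixedPoints.subring R.bottom G)) : p ≤ q := by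
  rw [← hq.induced_ideal_bot hR, le_induced_iff]
  intro a ha
  refine hq.isRadical hR ⊥ (mem_radical_of_under_le h fun g : G => ?_)
  rw [smul_bottom]
  exact p.res_mem _ ha

theorem under_isPrime (hp : p.IsPrime) (hR : R.NormResEqPow) :
    ((p.ideal ⊥).under (FixedPoints.subring R.bottom G)).IsPrime := by
  refine ⟨Ideal.comap_ne_top _ (hp.ideal_bot_ne_top hR), fun {s t} hst => ?_⟩
  have hle : induced (Ideal.span {(s : R.bottom)}) * induced (Ideal.span {(t : R.bottom)}) ≤ p := by
    rw [← hp.induced_ideal_bot hR]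
    refine (induced_mul_le _ _).trans (induced_mono ?_)
    rw [Ideal.span_singleton_mul_span_singleton, Ideal.span_singleton_le_iff_mem]
    exact hst
  have mem_of_le {r : FixedPoints.subring R.bottom G}
      (hr : induced (Ideal.span {(r : R.bottom)}) ≤ p) :
      (r : R.bottom) ∈ p.ideal ⊥ :=
    hr ⊥ (fixedPoint_mem_induced.2 (Ideal.mem_span_singleton_self _))
  exact (hp.le_or_le _ _ hle).imp mem_of_le mem_of_le

end TambaraIdeal.IsPrime

section Spec

variable {G : Type u} [Group G] [Finite G] {R : TambaraFunctor.{u, v} G}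

/-- The map `𝔭 ↦ 𝔭(G/e) ∩ R(G/e)^G` from the Nakaoka spectrum of `R` to the prime spectrum of
`R(G/e)^G`. -/
def invariantPrime (hR : R.NormResEqPow) (p : Spec R) :
    PrimeSpectrum (FixedPoints.subring R.bottom G) :=
  ⟨_, p.2.under_isPrime hR⟩

theorem invariantPrime_le_iff (hR : R.NormResEqPow) {p q : Spec R} :
    invariantPrime hR p ≤ invariantPrime hR q ↔ p ≤ q :=
  ⟨q.2.le_of_under_le hR, fun h => Ideal.comap_mono (h ⊥)⟩

theorem exists_invariantPrime_induced_eq (hR : R.NormResEqPow)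
    (Q : PrimeSpectrum (FixedPoints.subring R.bottom G)) :
    ∃ (P : Ideal R.bottom) (_ : P.IsPrime),
      invariantPrime hR ⟨induced P, isPrime_induced P⟩ = Q := by
  have := Algebra.IsInvariant.isIntegral (FixedPoints.subring R.bottom G) R.bottom G
  obtain ⟨⟨P, hP, hPQ⟩⟩ := Ideal.nonempty_primesOver (S := R.bottom) Q.asIdeal
  refine ⟨P, hP, PrimeSpectrum.ext (Ideal.ext fun s => ?_)⟩
  rw [hPQ.over]
  exact fixedPoint_mem_induced

/-- The isomorphism of posets `Spec R ≃ Spec (R(G/e)^G)`, `𝔭 ↦ 𝔭(G/e) ∩ R(G/e)^G`. -/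
def specOrderIso (hR : R.NormResEqPow) :
    Spec R ≃o PrimeSpectrum (FixedPoints.subring R.bottom G) :=
  RelIso.ofSurjective (OrderEmbedding.ofMapLEIff (invariantPrime hR)
    fun _ _ => invariantPrime_le_iff hR) fun Q =>
      let ⟨_, _, h⟩ := exists_invariantPrime_induced_eq hR Q
      ⟨_, h⟩

theorem TambaraIdeal.IsPrime.exists_eq_induced {p : TambaraIdeal R} (hp : p.IsPrime)
    (hR : R.NormResEqPow) : ∃ (P : Ideal R.bottom) (_ : P.IsPrime), p = induced P := by
  obtain ⟨P, hP, h⟩ := exists_invariantPrime_induced_eq hR (invariantPrime hR ⟨p, hp⟩)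
  exact ⟨P, hP, (congrArg Subtype.val ((specOrderIso hR).injective h)).symm⟩

end Spec

section Contraction

variable {G : Type u} [Group G] [Finite G] {R : TambaraFunctor.{u, v} G}
  {S : TambaraFunctor.{u, w} G} (f : Hom R S)

theorem comap_induced (I : Ideal S.bottom) :
    (induced I).comap f = induced (I.comap (f.app _)) := by
  refine TambaraIdeal.ext (funext fun H => Ideal.ext fun a => ?_)
  change f.app _ a ∈ (induced I).ideal H ↔ _
  rw [mem_induced, mem_induced]
  refine forall_congr' fun x => ?_
  rw [Ideal.mem_comap, eval, eval, f.app_res]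

theorem TambaraIdeal.comap_mono {I J : TambaraIdeal S} (h : I ≤ J) : I.comap f ≤ J.comap f :=
  fun H => Ideal.comap_mono (h H)

theorem TambaraIdeal.le_comap_sInf (I : TambaraIdeal R) :
    I ≤ (sInf {L : TambaraIdeal S | I ≤ L.comap f}).comap f :=
  fun H _ ha => mem_sInf.2 fun _ hL => hL H ha

theorem TambaraIdeal.sInf_le_iff_le_comap {I : TambaraIdeal R} {J : TambaraIdeal S} :
    sInf {L : TambaraIdeal S | I ≤ L.comap f} ≤ J ↔ I ≤ J.comap f :=
  ⟨fun h => (le_comap_sInf f I).trans (comap_mono f h), fun h => sInf_le h⟩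

theorem TambaraIdeal.IsPrime.comap {q : TambaraIdeal S} (hq : q.IsPrime) (hS : S.NormResEqPow) :
    (q.comap f).IsPrime := by
  obtain ⟨P, hP, rfl⟩ := hq.exists_eq_induced hS
  rw [comap_induced]
  exact isPrime_induced _

/-- The map of Nakaoka spectra given by contraction along a morphism of Tambara functors. -/
def specComap (hS : S.NormResEqPow) (q : Spec S) : Spec R := ⟨q.1.comap f, q.2.comap f hS⟩

variable {f}

theorem continuous_specComap (hS : S.NormResEqPow) : Continuous (specComap f hS) := by
  refine continuous_generateFrom_iff.2 ?_
  rintro _ ⟨I, rfl⟩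
  refine TopologicalSpace.isOpen_generateFrom_of_mem
    ⟨sInf {L : TambaraIdeal S | I ≤ L.comap f}, ?_⟩
  ext q
  exact not_congr (TambaraIdeal.sInf_le_iff_le_comap f).symm

theorem specComap_injective (hS : S.NormResEqPow)
    (hf : Function.Surjective (f.app (orbit (⊥ : Subgroup G)))) :
    Function.Injective (specComap f hS) := by
  intro q q' h
  have hbot : q.1.ideal ⊥ = q'.1.ideal ⊥ :=
    Ideal.comap_injective_of_surjective _ hf (congrArg (fun p : Spec R => p.1.ideal ⊥) h)
  refine Subtype.ext ?_
  rw [← q.2.induced_ideal_bot hS, hbot, q'.2.induced_ideal_bot hS]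

theorem specComap_surjective (hR : R.NormResEqPow) (hS : S.NormResEqPow)
    (hf : Function.Surjective (PrimeSpectrum.comap (f.app (orbit (⊥ : Subgroup G))))) :
    Function.Surjective (specComap f hS) := by
  intro p
  obtain ⟨P, hP, h⟩ := p.2.exists_eq_induced hR
  obtain ⟨Q, hQ⟩ := hf ⟨P, hP⟩
  have hQ' : Q.asIdeal.comap (f.app _) = P := congrArg PrimeSpectrum.asIdeal hQ
  refine ⟨⟨induced Q.asIdeal, isPrime_induced _⟩, Subtype.ext ?_⟩
  exact (comap_induced f _).trans ((congrArg induced hQ').trans h.symm)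

theorem specComap_bijective (hR : R.NormResEqPow) (hS : S.NormResEqPow)
    (hf : Function.Bijective (f.app (orbit (⊥ : Subgroup G)))) :
    Function.Bijective (specComap f hS) :=
  ⟨specComap_injective hS hf.2, specComap_surjective hR hS
    (PrimeSpectrum.comapEquiv (RingEquiv.ofBijective _ hf)).symm.surjective⟩

end Contraction

end TambaraFunctor

end

theorem mainTheorem7_general {G : Type u} [Group G] [Finite G] (R : TambaraFunctor.{u, v} G)
    (hR : R.NormResEqPow) :
    ∃ F : TambaraFunctor.Spec (TambaraFunctor.fixedPoint G R.bottom) → TambaraFunctor.Spec R,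
      (∀ q, (F q).1 = TambaraFunctor.TambaraIdeal.comap R.unit q.1) ∧
      Continuous F ∧ Function.Bijective F ∧
      ∃ e : TambaraFunctor.Spec R ≃o PrimeSpectrum (FixedPoints.subring R.bottom G),
        ∀ (p : TambaraFunctor.Spec R) (s : FixedPoints.subring R.bottom G),
          s ∈ (e p).asIdeal ↔ (s : R.bottom) ∈ p.1.ideal ⊥ := by
  have hS := TambaraFunctor.fixedPoint_normResEqPow (G := G) R.bottom
  exact ⟨TambaraFunctor.specComap R.unit hS, fun _ => rfl,
    TambaraFunctor.continuous_specComap hS,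
    TambaraFunctor.specComap_bijective hR hS R.unit_app_bot_bijective,
    TambaraFunctor.specOrderIso hR, fun _ _ => Iff.rfl⟩

theorem mainTheorem7 {G : Type u} [Group G] [Finite G] (R : TambaraFunctor.{u, v} G)
    (hR : ∀ (K H : Subgroup G) (f : FinGSet.orbit K →[G] FinGSet.orbit H),
      Function.Injective (R.res f)) :
    ∃ F : TambaraFunctor.Spec (TambaraFunctor.fixedPoint G R.bottom) → TambaraFunctor.Spec R,
      (∀ q, (F q).1 = TambaraFunctor.TambaraIdeal.comap R.unit q.1) ∧
      Continuous F ∧ Function.Bijective F ∧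
      ∃ e : TambaraFunctor.Spec R ≃o PrimeSpectrum (FixedPoints.subring R.bottom G),
        ∀ (p : TambaraFunctor.Spec R) (s : FixedPoints.subring R.bottom G),
          s ∈ (e p).asIdeal ↔ (s : R.bottom) ∈ p.1.ideal ⊥ := by
  exact mainTheorem7_general R (TambaraFunctor.NormResEqPow.of_res_injective hR)
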